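/- **Theorem 5.10.** Let $A=\{a,b\}$. An $A$-algebra is a nonempty set with two unary operations $a,b$; a pseudovariety is a class of finite algebras closed under homomorphic images, subalgebras and finite direct products. For a class $\mathsf V$ of finite algebras, a pro-$\mathsf V$ algebra is a compact Hausdorff topological algebra whose points are separated by continuous homomorphisms into members of $\mathsf V$ (profinite: $\mathsf V$ consists of all finite algebras), and $\overline\Omega_X\mathsf V$ denotes the free pro-$\mathsf V$ algebra over $X$. Let $\mathsf K$ be the class of all finite semigroups satisfying $x_1\cdots x_n y=x_1\cdots x_n$ for some $n\ge 1$, and let $\mathsf K^u$ be the class of all finite $A$-algebras satisfying the pseudoidentities $p\cdot x=q\cdot x$ for all semigroup pseudoidentities $p=q$ over $A$ that hold in $\mathsf K$. Here $p,q$ are elements of the free profinite semigroup over $A$, which acts on a finite $A$-algebra $U$ through its continuous homomorphism into the full transformation semigroup of $U$ that maps each letter to the corresponding operation of $U$. Then $\mathsf K^u$ is a pseudovariety of unary algebras; the free profinite semigroup over $A$, the free pro-$\mathsf K$ semigroup $\overline\Omega_A\mathsf K$ and the free pro-$\mathsf K^u$ algebra $\overline\Omega_x\mathsf K^u$ over $\{x\}$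 exist; and the following hold. 1. Let $\theta$ be the least closed congruence on $\overline\Omega_A\mathsf K$ containing $(ab^\omega,ba^\omega)$, where $s^\omega=\lim_n s^{n!}$. It consists of the diagonal, the pairs $(wab^\omega,wba^\omega)$ and the pairs $(wba^\omega,wab^\omega)$, with $w$ a finite, possibly empty, word over $A$. 2. There is an isomorphism of topological $A$-algebras $\varphi:\overline\Omega_x\mathsf K^u\to(\overline\Omega_A\mathsf K)^I$ with $\varphi(x)=1$, where $S^I$ is $S$ with a new isolated identity element $1$ and each letter acts on $S^I$ by left multiplication. 3. Let $\tilde\theta$ be the relation on $\overline\Omega_x\mathsf K^u$ that corresponds under $\varphi$ to the extension of $\theta$ to $(\overline\Omega_A\mathsf K)^I$ with $\{1\}$ as a singleton class. Then $\tilde\theta$ is a closed congruence, it is fully invariant (invariant under all continuous endomorphisms), and it is not profinite: the quotient topological algebra $\overline\Omega_x\mathsf K^u/\tilde\theta$ is not profinite. 4. There is a homeomorphism $g$ of $[0,1]$ onto a closed subspace of $\overline\Omega_x\mathsf K^u/\tilde\theta$ such that, for every infinite word $s_0s_1s_2\cdots$ over $A$, the prefixes of $s_0s_1s_2\cdots$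 converge in $(\overline\Omega_A\mathsf K)^I$ to an element $p$ of $\overline\Omega_A\mathsf K$, and $g\bigl(\sum_{n\ge0}d(s_n)2^{-n-1}\bigr)$ is the class of $\varphi^{-1}(p)$, where $d(a)=0$ and $d(b)=1$. In particular, there are a pseudovariety $\mathsf U$ of unary algebras and a fully invariant closed congruence on a free pro-$\mathsf U$ algebra that is not profinite. -/

import Mathlib

open Filter Topology
open scoped Nat

universe u v w

namespace ProUnary

/-! ## Classes of finite algebras

An algebra of a unary signature `A` is a type `U` with `[SMul A U]`: the symbol `c` acts as
`y ↦ c • y`, and the homomorphisms are the equivariant maps `U →[A] V`. Finite algebras live in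
`Type`, which contains an isomorphic copy of every finite algebra. -/

/-- A class of (finite) semigroups. -/
abbrev SemigroupClass := ∀ (T : Type) [Semigroup T], Prop

/-- A class of (finite) algebras of the unary signature `A`. -/
abbrev UnaryClass (A : Type) := ∀ (U : Type) [SMul A U], Prop

/-- The pseudovariety of all finite semigroups. -/
def finiteSemigroups : SemigroupClass := fun T _ => Finite T ∧ Nonempty T

/-- The pseudovariety of all finite `A`-algebras. -/
def finiteUnary (A : Type) : UnaryClass A := fun U _ => Finite U ∧ Nonempty U

/-- A pseudovariety of unary algebras: a class of finite (nonempty) algebras that is closed under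
homomorphic images, subalgebras and finite direct products. -/
structure IsUnaryPseudovariety {A : Type} (V : UnaryClass A) : Prop where
  finite : ∀ (U : Type) [SMul A U], V U → Finite U ∧ Nonempty U
  image : ∀ (U W : Type) [SMul A U] [SMul A W], V U →
    ∀ f : U →[A] W, Function.Surjective f → V W
  subalgebra : ∀ (U W : Type) [SMul A U] [SMul A W], V U → Nonempty W →
    ∀ f : W →[A] U, Function.Injective f → V W
  product : ∀ (J : Type) [Finite J] (U : J → Type) [∀ j, SMul A (U j)],
    (∀ j, V (U j)) → V (∀ j, U j)

/-! ## Pro-`V` algebras and free pro-`V` algebras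

A map into a finite (hence discrete) algebra is continuous iff it is locally constant. -/

/-- `S` is a pro-`V` semigroup: a compact Hausdorff topological semigroup whose points are
separated by continuous homomorphisms into members of `V`. -/
structure IsProSemigroup (V : SemigroupClass) (S : Type u) [Semigroup S] [TopologicalSpace S] :
    Prop where
  nonempty : Nonempty S
  continuous_mul : ContinuousMul S
  compact : CompactSpace S
  t2 : T2Space S
  separated : ∀ s t : S, s ≠ t → ∃ (T : Type) (_ : Semigroup T), V T ∧
    ∃ f : S →ₙ* T, IsLocallyConstant f ∧ f s ≠ f t

/-- `S` is a pro-`V` algebra of the (discrete) unary signature `A`. -/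
structure IsProUnary {A : Type} (V : UnaryClass A) (S : Type u) [SMul A S] [TopologicalSpace S] :
    Prop where
  nonempty : Nonempty S
  continuous_smul : ContinuousConstSMul A S
  compact : CompactSpace S
  t2 : T2Space S
  separated : ∀ s t : S, s ≠ t → ∃ (T : Type) (_ : SMul A T), V T ∧
    ∃ f : S →[A] T, IsLocallyConstant f ∧ f s ≠ f t

/-- `P` with `ι : X → P` is a free pro-`V` semigroup over the discrete space `X` (the universal
property is with respect to pro-`V` semigroups in `Type w`). -/
structure IsFreeProSemigroup (V : SemigroupClass) {X : Type} {P : Type u} [Semigroup P]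
    [TopologicalSpace P] (ι : X → P) : Prop where
  isPro : IsProSemigroup V P
  lift : ∀ (S : Type w) [Semigroup S] [TopologicalSpace S], IsProSemigroup V S →
    ∀ g : X → S, ∃! f : P →ₙ* S, Continuous f ∧ ∀ x, f (ι x) = g x

/-- `F` with `x : F` is a free pro-`V` algebra over the one-point space `{x}` (the universal
property is with respect to pro-`V` algebras in `Type w`). -/
structure IsFreeProUnary {A : Type} (V : UnaryClass A) {F : Type u} [SMul A F]
    [TopologicalSpace F] (x : F) : Prop where
  isPro : IsProUnary V F
  lift : ∀ (S : Type w) [SMul A S] [TopologicalSpace S], IsProUnary V S →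
    ∀ s : S, ∃! f : F →[A] S, Continuous f ∧ f x = s

/-! ## The semigroup with a new isolated identity -/

/-- `S^I`: the topology on `WithOne S` is that of the disjoint union of `S` and the new point `1`,
that is, a set is open iff its trace on `S` is open. -/
instance withOneTopology (S : Type u) [TopologicalSpace S] : TopologicalSpace (WithOne S) :=
  TopologicalSpace.coinduced (fun s : S => (s : WithOne S)) inferInstance

/-- The value of a (possibly empty) word under an assignment `ι` of its letters. -/
def wordVal {X : Type v} {S : Type u} [Semigroup S] (ι : X → S) (l : List X) : WithOne S :=
  (l.map fun c => (ι c : WithOne S)).prod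

/-- `e = s^ω`, that is, `e` is the limit of the sequence `s^(n!)`. -/
def IsOmegaPower {S : Type u} [Semigroup S] [TopologicalSpace S] (s e : S) : Prop :=
  Tendsto (fun n : ℕ => (s : WithOne S) ^ (n !)) atTop (𝓝 (e : WithOne S))

/-! ## The pseudovarieties `K` and `V^u` -/

/-- The finite semigroups that satisfy `x₁ ⋯ xₙ y = x₁ ⋯ xₙ` for some `n ≥ 1`. -/
def pseudoK : SemigroupClass := fun T _ =>
  (Finite T ∧ Nonempty T) ∧ ∃ n : ℕ, 1 ≤ n ∧ ∀ (l : List T) (y : T), l.length = n →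
    wordVal id l * (y : WithOne T) = wordVal id l

/-- The class `V` satisfies the semigroup pseudoidentity `p = q`, where `p` and `q` are elements
of a free profinite semigroup `P`. -/
def Satisfies (V : SemigroupClass) {P : Type u} [Semigroup P] [TopologicalSpace P] (p q : P) :
    Prop :=
  ∀ (T : Type) [Semigroup T], V T → ∀ f : P →ₙ* T, IsLocallyConstant f → f p = f q

/-- `V^u`: the finite `A`-algebras `U` that satisfy the pseudoidentities `p · x = q · x`, where
`p = q` runs over all the semigroup pseudoidentities over `A` satisfied by `V`. Here `p` and `q`
are elements of the free profinite semigroup `P` over `A`, which acts on the finite algebra `U`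
through the continuous homomorphism `ρ` of `P` into the (finite, discrete) full transformation
semigroup of `U` that sends each generator `c ∈ A` to the operation `c` of `U`. -/
def unaryOf (V : SemigroupClass) (A : Type) : UnaryClass A := fun U _ =>
  (Finite U ∧ Nonempty U) ∧
  ∀ (P : Type) [Semigroup P] [TopologicalSpace P] (ι : A → P),
    IsFreeProSemigroup.{0, 0} finiteSemigroups ι →
    ∀ ρ : P →ₙ* Function.End U, IsLocallyConstant ρ → (∀ c y, ρ (ι c) y = c • y) →
    ∀ p q : P, Satisfies V p q → ∀ y : U, ρ p y = ρ q y

/-! ## Congruences -/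

/-- The least closed congruence of the topological semigroup `S` that contains `R`. -/
def closedConGen {S : Type u} [Semigroup S] [TopologicalSpace S] (R : S → S → Prop) : Con S :=
  sInf {c : Con S | IsClosed {z : S × S | c z.1 z.2} ∧ ∀ p q, R p q → c p q}

/-- The quotient topology. -/
instance quotientTopology {A : Type} {F : Type u} [SMul A F] [TopologicalSpace F]
    (r : SMulCon A F) : TopologicalSpace r.Quotient :=
  inferInstanceAs (TopologicalSpace (Quotient r.toSetoid))

/-- The congruence is closed as a subset of `F × F`. -/
def IsClosedCon {A : Type} {F : Type u} [SMul A F] [TopologicalSpace F] (r : SMulCon A F) : Prop :=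
  IsClosed {z : F × F | r.toSetoid z.1 z.2}

/-- The congruence is invariant under all continuous endomorphisms. -/
def IsFullyInvariant {A : Type} {F : Type u} [SMul A F] [TopologicalSpace F] (r : SMulCon A F) :
    Prop :=
  ∀ f : F →[A] F, Continuous f → ∀ y z, r.toSetoid y z → r.toSetoid (f y) (f z)

/-- The congruence is profinite: the quotient topological algebra is profinite. -/
def IsProfiniteCon {A : Type} {F : Type u} [SMul A F] [TopologicalSpace F] (r : SMulCon A F) :
    Prop :=
  IsProUnary (finiteUnary A) r.Quotient

/-! ## The two-letter alphabet and the congruence of the Cantor function -/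

/-- The alphabet `{a, b}`. -/
inductive Letter : Type
  | a : Letter
  | b : Letter

/-- The letters as binary digits. -/
def Letter.digit : Letter → Fin 2
  | Letter.a => 0
  | Letter.b => 1

section Cantor

variable {P : Type u} [Semigroup P] [TopologicalSpace P] (ι : Letter → P)

/-- `p = w a b^ω` and `q = w b a^ω` for some finite (possibly empty) word `w`. -/
def CantorPair (p q : P) : Prop :=
  ∃ (w : List Letter) (e f : P), IsOmegaPower (ι Letter.a) e ∧ IsOmegaPower (ι Letter.b) f ∧
    (p : WithOne P) = wordVal ι w * ((ι Letter.a * f : P) : WithOne P) ∧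
    (q : WithOne P) = wordVal ι w * ((ι Letter.b * e : P) : WithOne P)

/-- The closed congruence generated by the pair `(a b^ω, b a^ω)`. -/
def cantorCon : Con P :=
  closedConGen fun p q => ∃ e f : P, IsOmegaPower (ι Letter.a) e ∧ IsOmegaPower (ι Letter.b) f ∧
    p = ι Letter.a * f ∧ q = ι Letter.b * e

/-- `p` is the right infinite word `s 0, s 1, s 2, …`, that is, the limit of its finite
prefixes. -/
def IsInfiniteWord (s : ℕ → Letter) (p : P) : Prop :=
  Tendsto (fun n : ℕ => wordVal ι ((List.range n).map s)) atTop (𝓝 (p : WithOne P))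

end Cantor

end ProUnary

open ProUnary

namespace ProUnary

/-! Everything is transported to one concrete model: the monoid `ProWord` of finite and infinite
words, the inverse limit of words truncated to length `n`. Finite words are dense in it and infinite
words are left zeros. Its nonempty words form the free pro-`K` semigroup, and the same monoid, with
letters acting by left multiplication and generated by the empty word, is the free pro-`K^u`
algebra. The latter rests on `unaryOf_pseudoK_iff`: a finite algebra lies in `K^u` exactly when all
long enough words absorb whatever is applied before them. One direction combines a pigeonhole on
prefixes with a pseudoidentity `p e r = p e`, where `e` is a cluster point of the powers of some
`q`; the other factors the action through truncated words.

On words, `cantor` records a binary value together with a gap, which is `2⁻ⁿ` for words of length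
`n` and zero for infinite words. The gap keeps finite words apart from all others, while two
distinct infinite words are identified exactly when they are the two expansions of one dyadic
rational (`cantor_eq_iff`). The kernel of this continuous map is a closed congruence
(`cantor_mul_congr`), and its nontrivial pairs are, up to symmetry, left translates of the
generating pair, so it is the least closed congruence containing that pair (`cantorCon_iff`).

Continuous endomorphisms of the free algebra are right multiplications (`map_eq_mul`), which gives
full invariance. The quotient is compact and embeds in the plane, where infinite words fill the
segment `[0,1] × {0}`. Locally constant maps cannot separate points of a connected segment, so the
quotient is not profinite. -/

/-- A compact Hausdorff space whose points are separated by locally constant maps `h i` receives a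
continuous map from any space that carries compatible locally constant maps `k i`, as soon as the
compatibility holds on a dense subset. -/
theorem exists_continuous_lift {M S W I : Type*} [TopologicalSpace M] [TopologicalSpace S]
    [CompactSpace S] {T : I → Type*} (h : ∀ i, S → T i)
    (hh : ∀ i, IsLocallyConstant (h i)) (sep : ∀ s t, (∀ i, h i s = h i t) → s = t)
    (j : W → M) (hj : DenseRange j) (ψ : W → S) (k : ∀ i, M → T i)
    (hk : ∀ i, IsLocallyConstant (k i)) (hkj : ∀ i w, k i (j w) = h i (ψ w)) :
    ∃ f : M → S, Continuous f ∧ ∀ i m, h i (f m) = k i m := by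
  set Γ : Set (M × S) := {z | ∀ i, h i z.2 = k i z.1} with hΓ
  have hΓc : IsClosed Γ := by
    have : Γ = ⋂ i, (fun z : M × S => (h i z.2, k i z.1)) ⁻¹' {p | p.1 = p.2} := by
      ext z; simp [hΓ]
    rw [this]
    refine isClosed_iInter fun i => ?_
    rw [← isOpen_compl_iff, ← Set.preimage_compl]
    exact ((hh i).comp_continuous continuous_snd).prodMk
      ((hk i).comp_continuous continuous_fst) _
  -- Compactness of `S` makes the projection of the closed relation `Γ` closed; it contains a dense
  -- set, so it is all of `M`.
  have hcl : IsClosedMap (Prod.fst : M × S → M) := isClosedMap_fst_of_compactSpace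
  have hsurj : ∀ m, ∃ s, (m, s) ∈ Γ := by
    intro m
    have h1 : Prod.fst '' Γ = Set.univ := by
      refine Set.eq_univ_of_univ_subset ?_
      rw [← hj.closure_range]
      refine closure_minimal ?_ (hcl _ hΓc)
      rintro _ ⟨w, rfl⟩
      exact ⟨(j w, ψ w), fun i => (hkj i w).symm, rfl⟩
    have h2 : m ∈ Prod.fst '' Γ := h1 ▸ Set.mem_univ m
    obtain ⟨⟨m', s⟩, hz, rfl⟩ := h2
    exact ⟨s, hz⟩
  choose f hf using hsurj
  refine ⟨f, continuous_iff_isClosed.2 fun C hC => ?_, fun i m => hf m i⟩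
  -- By separation the fibres of `Γ` are single points, so preimages of closed sets are projections
  -- of closed sets.
  have : f ⁻¹' C = Prod.fst '' (Γ ∩ Prod.snd ⁻¹' C) := by
    ext m
    constructor
    · exact fun hm => ⟨(m, f m), ⟨hf m, hm⟩, rfl⟩
    · rintro ⟨⟨m', s⟩, ⟨hz, hs⟩, rfl⟩
      have : f m' = s := sep _ _ fun i => (hf m' i).trans (hz i).symm
      simpa [this] using hs
  rw [this]
  exact hcl _ (hΓc.inter (hC.preimage continuous_snd))

/-! ## Free pro-`V` semigroups -/

/-- A finite semigroup in `V` is a pro-`V` semigroup in the discrete topology. -/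
theorem isProSemigroup_discrete {V : SemigroupClass} {T : Type} [Semigroup T] [TopologicalSpace T]
    [DiscreteTopology T] [Finite T] [Nonempty T] (hT : V T) : IsProSemigroup V T where
  nonempty := inferInstance
  continuous_mul := inferInstance
  compact := inferInstance
  t2 := inferInstance
  separated _ _ hst := ⟨T, _, hT, MulHom.id T, IsLocallyConstant.of_discrete _, hst⟩

/-- Universal properties test against objects of `Type w`, while finite members of `V` live in
`Type`; lifting bridges the two universes. -/
theorem IsProSemigroup.ulift {V : SemigroupClass} {S : Type u} [Semigroup S] [TopologicalSpace S]
    (hS : IsProSemigroup V S) : IsProSemigroup V (ULift.{w} S) := by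
  obtain ⟨h1, h2, h3, h4, h5⟩ := hS
  refine ⟨inferInstance, ⟨?_⟩, inferInstance, inferInstance, fun s t hst => ?_⟩
  · exact continuous_uliftUp.comp
      ((continuous_uliftDown.comp continuous_fst).mul (continuous_uliftDown.comp continuous_snd))
  · obtain ⟨T, _, hT, f, hf, hfs⟩ := h5 s.down t.down fun h => hst (ULift.ext _ _ h)
    exact ⟨T, _, hT, f.comp ⟨ULift.down, fun _ _ => rfl⟩,
      hf.comp_continuous continuous_uliftDown, hfs⟩

theorem IsFreeProSemigroup.exists_lift {V : SemigroupClass} {X : Type} {P : Type u} [Semigroup P]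
    [TopologicalSpace P] {ι : X → P} (hP : IsFreeProSemigroup.{u, w} V ι) (S : Type)
    [Semigroup S] [TopologicalSpace S] (hS : IsProSemigroup V S) (g : X → S) :
    ∃! f : P →ₙ* S, Continuous f ∧ ∀ x, f (ι x) = g x := by
  obtain ⟨f, ⟨hf, hfx⟩, hu⟩ := hP.lift (ULift.{w} S) hS.ulift fun x => ULift.up (g x)
  refine ⟨(⟨ULift.down, fun _ _ => rfl⟩ : ULift.{w} S →ₙ* S).comp f,
    ⟨continuous_uliftDown.comp hf, fun x => congrArg ULift.down (hfx x)⟩, ?_⟩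
  rintro f' ⟨hf', hfx'⟩
  rw [← hu ((⟨ULift.up, fun _ _ => rfl⟩ : S →ₙ* ULift.{w} S).comp f')
    ⟨continuous_uliftUp.comp hf', fun x => congrArg ULift.up (hfx' x)⟩]
  rfl

theorem IsFreeProSemigroup.exists_finite_lift {V : SemigroupClass} {X : Type} {P : Type u}
    [Semigroup P] [TopologicalSpace P] {ι : X → P} (hP : IsFreeProSemigroup.{u, w} V ι) (T : Type)
    [Semigroup T] [Finite T] [Nonempty T] (hT : V T) (g : X → T) :
    ∃! f : P →ₙ* T, IsLocallyConstant f ∧ ∀ x, f (ι x) = g x := by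
  let _ : TopologicalSpace T := ⊥
  have : DiscreteTopology T := ⟨rfl⟩
  simpa only [IsLocallyConstant.iff_continuous] using
    hP.exists_lift T (isProSemigroup_discrete hT) g

/-- A pro-`V` semigroup topologically generated by `ι` is free as soon as every map of the
generators into a member of `V` extends. -/
theorem IsProSemigroup.isFree {V : SemigroupClass} {X : Type} {P : Type u} [Semigroup P]
    [TopologicalSpace P] {ι : X → P} (hP : IsProSemigroup V P)
    (hd : DenseRange (FreeSemigroup.lift ι))
    (hl : ∀ (T : Type) [Semigroup T], V T → ∀ g : X → T,
      ∃ f : P →ₙ* T, IsLocallyConstant f ∧ ∀ x, f (ι x) = g x) :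
    IsFreeProSemigroup.{u, w} V ι := by
  refine ⟨hP, fun S _ _ hS g => ?_⟩
  have := hS.compact
  have := hS.t2
  -- All continuous homomorphisms into members of `V`. They separate points, and their extensions to
  -- `P` are glued by `exists_continuous_lift`.
  let I := {p : (Σ (T : Type) (_ : Semigroup T), S →ₙ* T) //
    @V p.1 p.2.1 ∧ IsLocallyConstant p.2.2}
  let _ (i : I) : Semigroup i.1.1 := i.1.2.1
  let h (i : I) : S →ₙ* i.1.1 := i.1.2.2
  have sep : ∀ s t, (∀ i, h i s = h i t) → s = t := by
    intro s t hst
    by_contra hne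
    obtain ⟨T, _, hT, f, hf, hne⟩ := hS.separated s t hne
    exact hne (hst ⟨⟨T, _, f⟩, hT, hf⟩)
  have hk : ∀ i : I, ∃ k : P →ₙ* i.1.1, IsLocallyConstant k ∧ ∀ x, k (ι x) = h i (g x) :=
    fun i => hl i.1.1 i.2.1 fun x => h i (g x)
  choose k hk hkx using hk
  have hkj : ∀ i w, k i (FreeSemigroup.lift ι w) = h i (FreeSemigroup.lift g w) := by
    intro i w
    induction w using FreeSemigroup.recOnMul with
    | ih1 x => simpa using hkx i x
    | ih2 x y ihx ihy => rw [map_mul, map_mul, map_mul, map_mul, FreeSemigroup.lift_of,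
        FreeSemigroup.lift_of, hkx, ihy]
  obtain ⟨f, hf, hfk⟩ := exists_continuous_lift (fun i => h i) (fun i => i.2.2) sep _ hd
    (FreeSemigroup.lift g) (fun i => k i) hk hkj
  refine ⟨⟨f, fun p q => sep _ _ fun i => ?_⟩, ⟨hf, fun x => sep _ _ fun i => ?_⟩, ?_⟩
  · rw [map_mul, hfk, hfk, hfk, map_mul]
  · exact (hfk i _).trans (hkx i x)
  · rintro f' ⟨hf', hfx'⟩
    refine DFunLike.coe_injective (hd.equalizer hf' hf ?_)
    funext w
    refine congrFun (congrArg DFunLike.coe (FreeSemigroup.hom_ext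
      (f := f'.comp (FreeSemigroup.lift ι))
      (g := MulHom.comp ⟨f, fun p q => sep _ _ fun i => by
        rw [map_mul, hfk, hfk, hfk, map_mul]⟩ (FreeSemigroup.lift ι)) ?_)) w
    funext x
    simp only [MulHom.coe_comp, Function.comp, FreeSemigroup.lift_of, hfx', MulHom.coe_mk]
    exact sep _ _ fun i => ((hfk i _).trans (hkx i x)).symm

/-! ## Free pro-`V` unary algebras -/

/-- The action of words on a unary algebra. -/
def wordAct {A : Type v} {U : Type u} [SMul A U] (l : List A) (y : U) : U :=
  l.foldr (· • ·) y

@[simp] theorem wordAct_nil {A : Type v} {U : Type u} [SMul A U] (y : U) :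
    wordAct ([] : List A) y = y := rfl

@[simp] theorem wordAct_cons {A : Type v} {U : Type u} [SMul A U] (c : A) (l : List A) (y : U) :
    wordAct (c :: l) y = c • wordAct l y := rfl

theorem wordAct_append {A : Type v} {U : Type u} [SMul A U] (l l' : List A) (y : U) :
    wordAct (l ++ l') y = wordAct l (wordAct l' y) := by
  simp [wordAct]

theorem map_wordAct {A : Type v} {U : Type u} {W : Type w} [SMul A U] [SMul A W] (f : U →[A] W)
    (l : List A) (y : U) : f (wordAct l y) = wordAct l (f y) := by
  induction l with
  | nil => rfl
  | cons c l ih => simp [ih]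

theorem isProUnary_discrete {A : Type} {V : UnaryClass A} {T : Type} [SMul A T]
    [TopologicalSpace T] [DiscreteTopology T] [Finite T] [Nonempty T] (hT : V T) :
    IsProUnary V T where
  nonempty := inferInstance
  continuous_smul := ⟨fun _ => continuous_of_discreteTopology⟩
  compact := inferInstance
  t2 := inferInstance
  separated _ _ hst := ⟨T, _, hT, MulActionHom.id A, IsLocallyConstant.of_discrete _, hst⟩

theorem IsProUnary.ulift {A : Type} {V : UnaryClass A} {S : Type u} [SMul A S]
    [TopologicalSpace S] (hS : IsProUnary V S) : IsProUnary V (ULift.{w} S) := by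
  obtain ⟨h1, h2, h3, h4, h5⟩ := hS
  refine ⟨inferInstance, ⟨fun c => ?_⟩, inferInstance, inferInstance, fun s t hst => ?_⟩
  · exact continuous_uliftUp.comp ((continuous_const_smul c).comp continuous_uliftDown)
  · obtain ⟨T, _, hT, f, hf, hfs⟩ := h5 s.down t.down fun h => hst (ULift.ext _ _ h)
    exact ⟨T, _, hT, f.comp (⟨ULift.down, fun _ _ => rfl⟩ : ULift.{w} S →[A] S),
      hf.comp_continuous continuous_uliftDown, hfs⟩

theorem IsFreeProUnary.exists_lift {A : Type} {V : UnaryClass A} {F : Type u} [SMul A F]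
    [TopologicalSpace F] {x : F} (hF : IsFreeProUnary.{u, w} V x) (S : Type)
    [SMul A S] [TopologicalSpace S] (hS : IsProUnary V S) (s : S) :
    ∃! f : F →[A] S, Continuous f ∧ f x = s := by
  obtain ⟨f, ⟨hf, hfx⟩, hu⟩ := hF.lift (ULift.{w} S) hS.ulift (ULift.up s)
  refine ⟨(⟨ULift.down, fun _ _ => rfl⟩ : ULift.{w} S →[A] S).comp f,
    ⟨continuous_uliftDown.comp hf, congrArg ULift.down hfx⟩, ?_⟩
  rintro f' ⟨hf', hfx'⟩
  rw [← hu ((⟨ULift.up, fun _ _ => rfl⟩ : S →[A] ULift.{w} S).comp f')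
    ⟨continuous_uliftUp.comp hf', congrArg ULift.up hfx'⟩]
  rfl

theorem IsFreeProUnary.exists_finite_lift {A : Type} {V : UnaryClass A} {F : Type u} [SMul A F]
    [TopologicalSpace F] {x : F} (hF : IsFreeProUnary.{u, w} V x) (T : Type)
    [SMul A T] [Finite T] [Nonempty T] (hT : V T) (s : T) :
    ∃! f : F →[A] T, IsLocallyConstant f ∧ f x = s := by
  let _ : TopologicalSpace T := ⊥
  have : DiscreteTopology T := ⟨rfl⟩
  simpa only [IsLocallyConstant.iff_continuous] using
    hF.exists_lift T (isProUnary_discrete hT) s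

theorem IsProUnary.isFree {A : Type} {V : UnaryClass A} {F : Type u} [SMul A F]
    [TopologicalSpace F] {x : F} (hF : IsProUnary V F)
    (hd : DenseRange fun l : List A => wordAct l x)
    (hl : ∀ (T : Type) [SMul A T], V T → ∀ t : T,
      ∃ f : F →[A] T, IsLocallyConstant f ∧ f x = t) :
    IsFreeProUnary.{u, w} V x := by
  refine ⟨hF, fun S _ _ hS s => ?_⟩
  have := hS.compact
  have := hS.t2
  let I := {p : (Σ (T : Type) (_ : SMul A T), S →[A] T) //
    @V p.1 p.2.1 ∧ IsLocallyConstant p.2.2}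
  let _ (i : I) : SMul A i.1.1 := i.1.2.1
  let h (i : I) : S →[A] i.1.1 := i.1.2.2
  have sep : ∀ s t, (∀ i, h i s = h i t) → s = t := by
    intro s t hst
    by_contra hne
    obtain ⟨T, _, hT, f, hf, hne⟩ := hS.separated s t hne
    exact hne (hst ⟨⟨T, _, f⟩, hT, hf⟩)
  have hk : ∀ i : I, ∃ k : F →[A] i.1.1, IsLocallyConstant k ∧ k x = h i s :=
    fun i => hl i.1.1 i.2.1 (h i s)
  choose k hk hkx using hk
  obtain ⟨f, hf, hfk⟩ := exists_continuous_lift (fun i => h i) (fun i => i.2.2) sep _ hd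
    (fun l => wordAct l s) (fun i => k i) hk fun i l => by
      rw [map_wordAct, map_wordAct, hkx]
  let f₁ : F →[A] S := ⟨f, fun c y => sep _ _ fun i => by
    rw [hfk, id, map_smul, map_smul, hfk]⟩
  have hfx : f₁ x = s := sep _ _ fun i => (hfk i _).trans (hkx i)
  refine ⟨f₁, ⟨hf, hfx⟩, ?_⟩
  rintro f' ⟨hf', hfx'⟩
  refine DFunLike.coe_injective (hd.equalizer hf' hf ?_)
  funext l
  change f' (wordAct l x) = f₁ (wordAct l x)
  rw [map_wordAct, map_wordAct, hfx', hfx]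

/-! ## Existence of free profinite semigroups -/

/-- The closure of the diagonal image of the free semigroup in the product of all its finite
quotients is a free profinite semigroup. -/
theorem exists_isFreeProSemigroup_finite (A : Type) [Nonempty A] :
    ∃ (P : Type) (_ : Semigroup P) (_ : TopologicalSpace P) (ι : A → P),
      IsFreeProSemigroup.{0, w} finiteSemigroups ι := by
  -- Indexing by congruences of finite index, rather than by finite semigroups, keeps the product in
  -- `Type`.
  let I := {c : Con (FreeSemigroup A) // Finite c.Quotient}
  let Q : I → Type := fun i => i.1.Quotient
  let _ (i : I) : Semigroup (Q i) := inferInstanceAs (Semigroup i.1.Quotient)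
  let _ (i : I) : TopologicalSpace (Q i) := ⊥
  have (i : I) : DiscreteTopology (Q i) := ⟨rfl⟩
  have (i : I) : Finite (Q i) := i.2
  have hne (i : I) : Nonempty (Q i) := ⟨(i.1.mkMulHom (FreeSemigroup.of (Classical.arbitrary A)))⟩
  let δ : FreeSemigroup A →ₙ* ∀ i, Q i := ⟨fun s i => i.1.mkMulHom s, fun s t => by
    funext i; exact map_mul i.1.mkMulHom s t⟩
  let P := (MulHom.srange δ).topologicalClosure
  let j : FreeSemigroup A →ₙ* P :=
    ⟨fun s => ⟨δ s, subset_closure ⟨s, rfl⟩⟩, fun s t => Subtype.ext (map_mul δ s t)⟩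
  let ι : A → P := fun c => j (FreeSemigroup.of c)
  have hj : FreeSemigroup.lift ι = j := FreeSemigroup.hom_ext (by ext; simp [ι])
  have hP : IsClosed (P : Set (∀ i, Q i)) := isClosed_closure
  have hcoord (i : I) : ∃ f : P →ₙ* Q i, IsLocallyConstant f ∧ ∀ p, f p = p.1 i :=
    ⟨⟨fun p => p.1 i, fun _ _ => rfl⟩, (IsLocallyConstant.iff_continuous _).2
      ((continuous_apply i).comp continuous_subtype_val), fun _ => rfl⟩
  refine ⟨P, inferInstance, inferInstance, ι, IsProSemigroup.isFree ⟨?_, ?_, ?_, ?_, ?_⟩ ?_ ?_⟩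
  · exact ⟨ι (Classical.arbitrary A)⟩
  · infer_instance
  · exact isCompact_iff_compactSpace.1 hP.isCompact
  · infer_instance
  · intro s t hst
    obtain ⟨i, hi⟩ := Function.ne_iff.1 fun h => hst (Subtype.ext h)
    obtain ⟨f, hf, hfp⟩ := hcoord i
    exact ⟨Q i, _, ⟨i.2, hne i⟩, f, hf, by rwa [hfp, hfp]⟩
  · rw [hj]
    rintro ⟨p, hp⟩
    rw [closure_subtype]
    refine closure_mono ?_ hp
    rintro _ ⟨s, rfl⟩
    exact ⟨j s, ⟨s, rfl⟩, rfl⟩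
  · intro T _ hT g
    have := hT.1
    -- The extension of `g` factors through the coordinate of its kernel congruence, which has
    -- finite index.
    let k := FreeSemigroup.lift g
    let kl : (Con.ker k).Quotient → T := Quotient.lift k fun _ _ h => h
    have hkl : Function.Injective kl := by
      rintro ⟨s⟩ ⟨t⟩ h
      exact Quotient.sound h
    have hmul (p q : (Con.ker k).Quotient) : kl (p * q) = kl p * kl q := by
      induction p, q using Con.induction_on₂ with
      | _ s t => exact map_mul k s t
    let i : I := ⟨Con.ker k, Finite.of_injective _ hkl⟩
    obtain ⟨f, hf, hfp⟩ := hcoord i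
    refine ⟨⟨fun p => kl (f p), fun p q => ?_⟩, hf.comp _, fun x => ?_⟩
    · rw [map_mul]
      exact hmul (f p) (f q)
    · simp only [MulHom.coe_mk, hfp]
      exact FreeSemigroup.lift_of g x

/-! ## Membership in `K` and in `K^u` -/

section wordVal

variable {X : Type v} {S : Type u} [Semigroup S] (ι : X → S)

@[simp] theorem wordVal_nil : wordVal ι [] = 1 := rfl

@[simp] theorem wordVal_cons (c : X) (l : List X) : wordVal ι (c :: l) = ι c * wordVal ι l := by
  simp [wordVal]

theorem wordVal_append (l l' : List X) : wordVal ι (l ++ l') = wordVal ι l * wordVal ι l' := by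
  simp [wordVal]

theorem wordVal_map {Y : Type w} (g : Y → X) (l : List Y) :
    wordVal ι (l.map g) = wordVal (ι ∘ g) l := by
  simp [wordVal, Function.comp_def]

end wordVal

/-- The first `n` factors absorb everything after them, so the length need not be exact and `y` may
be the adjoined identity. -/
theorem pseudoK_iff {T : Type} [Semigroup T] : pseudoK T ↔ (Finite T ∧ Nonempty T) ∧
    ∃ n : ℕ, 1 ≤ n ∧ ∀ l : List T, n ≤ l.length → ∀ y : WithOne T,
      wordVal id l * y = wordVal id l := by
  refine and_congr_right fun _ => exists_congr fun n => and_congr_right fun _ =>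
    ⟨fun h l hl y => ?_, fun h l y hl => h l hl.ge y⟩
  have key (z : WithOne T) : wordVal id (l.take n) * z = wordVal id (l.take n) := by
    induction z using WithOne.recOneCoe with
    | one => exact mul_one _
    | coe z => exact h _ _ (by simpa using hl)
  rw [← List.take_append_drop n l, wordVal_append, mul_assoc, key, key]

/-- If `p q = p` in the transformation semigroup of an algebra of `K^u`, then `p` absorbs
everything on the right. -/
theorem absorb_of_mul_eq {P U : Type} [Semigroup P] [TopologicalSpace P]
    [CompactSpace P] (ρ : P →ₙ* Function.End U) (hρ : IsLocallyConstant ρ)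
    (h : ∀ p q : P, Satisfies pseudoK p q → ρ p = ρ q) {p q : P} (hpq : ρ p * ρ q = ρ p) (r : P) :
    ρ p * ρ r = ρ p := by
  -- `it k` is the power `q^(k+1)`. A cluster point `e` of these agrees, under any locally constant
  -- map, with arbitrarily high powers of `q`.
  let it (k : ℕ) : P := (q * ·)^[k] q
  have it_succ (k : ℕ) : it (k + 1) = q * it k := Function.iterate_succ_apply' _ _ _
  obtain ⟨e, he⟩ := exists_clusterPt_of_compactSpace (map it atTop)
  have hfreq {T : Type} (f : P → T) (hf : IsLocallyConstant f) (n : ℕ) :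
      ∃ k, n ≤ k ∧ f (it k) = f e := by
    have h1 : ∃ᶠ k in atTop, f (it k) = f e :=
      (mapClusterPt_iff_frequently.1 he) _ (hf.eventually_eq e)
    obtain ⟨k, hk, hke⟩ := frequently_atTop.1 h1 n
    exact ⟨k, hk, hke⟩
  -- In a member of `K` the image of `e` is a product of at least `n` factors, hence absorbs the
  -- image of `r`.
  have hsat : Satisfies pseudoK (p * e * r) (p * e) := by
    intro T _ hT f hf
    obtain ⟨-, n, -, hn⟩ := pseudoK_iff.1 hT
    obtain ⟨k, hk, hke⟩ := hfreq f hf n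
    have hval : ∀ k, (f (it k) : WithOne T) = wordVal id (List.replicate (k + 1) (f q)) := by
      intro k
      induction k with
      | zero => simp [it]
      | succ k ih => rw [it_succ, map_mul, WithOne.coe_mul, ih, List.replicate_succ (n := k + 1),
          wordVal_cons, id]
    have h2 : f e * f r = f e := by
      rw [← WithOne.coe_inj, WithOne.coe_mul, ← hke, hval]
      exact hn _ (by simp; omega) _
    rw [map_mul, map_mul, mul_assoc, h2]
  -- `ρ e` is the image of some power of `q`, and `ρ p` is unchanged by each factor `ρ q`.
  have hpe : ρ p * ρ e = ρ p := by
    obtain ⟨k, -, hke⟩ := hfreq ρ hρ 0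
    rw [← hke]
    clear hke
    induction k with
    | zero => exact hpq
    | succ k ih => rw [it_succ, map_mul, ← mul_assoc, hpq, ih]
  have := h _ _ hsat
  rwa [map_mul, map_mul, hpe] at this

theorem exists_absorb_of_unaryOf {A : Type} [Nonempty A] {U : Type} [SMul A U]
    (hU : unaryOf pseudoK A U) :
    ∃ n : ℕ, ∀ w : List A, n ≤ w.length → ∀ (l : List A) (y : U),
      wordAct w (wordAct l y) = wordAct w y := by
  obtain ⟨⟨_, _⟩, hU⟩ := hU
  obtain ⟨P, _, _, ι, hP⟩ := exists_isFreeProSemigroup_finite.{0} A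
  have := hP.isPro.compact
  have : Finite (Function.End U) := inferInstanceAs (Finite (U → U))
  obtain ⟨ρ, ⟨hρ, hρι⟩, -⟩ := hP.exists_finite_lift (Function.End U)
    ⟨inferInstance, inferInstance⟩ fun c y => c • y
  have hρι (c : A) (y : U) : ρ (ι c) y = c • y := congrFun (hρι c) y
  have hsat (p q : P) (hpq : Satisfies pseudoK p q) : ρ p = ρ q :=
    funext (hU P ι hP ρ hρ hρι p q hpq)
  have hword (c : A) (l : List A) : ∃ p, ρ p = wordAct (c :: l) := by
    induction l generalizing c with
    | nil => exact ⟨ι c, funext (hρι c)⟩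
    | cons d l ih =>
      obtain ⟨p, hp⟩ := ih d
      refine ⟨ι c * p, funext fun y => ?_⟩
      rw [map_mul, hp]
      exact hρι c _
  have hword' (l : List A) (hl : l ≠ []) : ∃ p, ρ p = wordAct l := by
    obtain ⟨c, l, rfl⟩ := List.exists_cons_of_ne_nil hl
    exact hword c l
  refine ⟨Nat.card (Function.End U) + 1, fun w hw l y => ?_⟩
  -- Pigeonhole: the nonempty prefixes of `w` outnumber the transformations of `U`. The empty prefix
  -- is left out because it has no counterpart in the semigroup `P`.
  let pre : Fin w.length → Function.End U := fun i => wordAct (w.take (i + 1))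
  obtain ⟨i, j, hij, hpre⟩ : ∃ i j : Fin w.length, i < j ∧ pre i = pre j := by
    have : ¬ Function.Injective pre := fun h => by
      have := Nat.card_le_card_of_injective pre h
      rw [Nat.card_fin] at this
      omega
    obtain ⟨i, j, h, hne⟩ := Function.not_injective_iff.1 this
    rcases lt_or_gt_of_ne hne with h' | h'
    exacts [⟨i, j, h', h⟩, ⟨j, i, h', h.symm⟩]
  have hi := i.2
  have hj := j.2
  have hij' : i.1 < j.1 := hij
  obtain ⟨p, hp⟩ := hword' (w.take (i + 1)) (by
    rw [← List.length_pos_iff, List.length_take]; omega)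
  obtain ⟨q, hq⟩ := hword' ((w.take (j + 1)).drop (i + 1)) (by
    rw [← List.length_pos_iff]; simp; omega)
  -- `p` acts as the shorter prefix and `q` as the factor of `w` between the two, so their product
  -- acts as the longer prefix.
  have hpq : ρ p * ρ q = ρ p := by
    have h1 : w.take (j + 1) = w.take (i + 1) ++ (w.take (j + 1)).drop (i + 1) := by
      conv_lhs => rw [← List.take_append_drop (i + 1) (w.take (j + 1))]
      rw [List.take_take, min_eq_left (by omega)]
    rw [hp, hq]
    refine Eq.trans (funext fun y => ?_) hpre.symm
    exact (wordAct_append _ _ _).symm.trans (congrArg (wordAct · y) h1.symm)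
  have habs (l : List A) (y : U) :
      wordAct (w.take (i + 1)) (wordAct l y) = wordAct (w.take (i + 1)) y := by
    cases l with
    | nil => rfl
    | cons c l =>
      obtain ⟨r, hr⟩ := hword c l
      have := congrFun (absorb_of_mul_eq ρ hρ hsat hpq r) y
      rwa [hp, hr] at this
  rw [← List.take_append_drop (i + 1) w, wordAct_append, wordAct_append, habs, habs, habs]

/-! ## Truncated words -/

theorem take_take_append {A : Type v} (n : ℕ) (l l' : List A) :
    (l.take n ++ l').take n = (l ++ l').take n := by
  rcases le_total l.length n with h | h
  · rw [List.take_of_length_le h]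
  · rw [List.take_append_of_le_length (by simpa using h), List.take_append_of_le_length h,
      List.take_take, min_self]

theorem take_append_take {A : Type v} (n : ℕ) (l l' : List A) :
    (l ++ l'.take n).take n = (l ++ l').take n := by
  rw [List.take_append, List.take_append, List.take_take, min_eq_left (Nat.sub_le _ _)]

/-- The words of length at most `n`. -/
def Trunc (A : Type v) (n : ℕ) : Type v := {l : List A // l.length ≤ n}

namespace Trunc

variable {A : Type v} {n : ℕ}

/-- The prefix of length `n`. -/
def mk (n : ℕ) (l : List A) : Trunc A n := ⟨l.take n, by simp⟩

@[simp] theorem val_mk (l : List A) : (mk n l).1 = l.take n := rfl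

theorem ext {s t : Trunc A n} (h : s.1 = t.1) : s = t := Subtype.ext h

theorem take_val (t : Trunc A n) : t.1.take n = t.1 := List.take_of_length_le t.2

/-- The product of two words is the prefix of their concatenation. -/
instance : Monoid (Trunc A n) where
  mul s t := mk n (s.1 ++ t.1)
  one := ⟨[], Nat.zero_le _⟩
  mul_assoc s t r := ext (by
    change ((s.1 ++ t.1).take n ++ r.1).take n = (s.1 ++ (t.1 ++ r.1).take n).take n
    rw [take_take_append, take_append_take, List.append_assoc])
  one_mul t := ext t.take_val
  mul_one t := ext (by
    change (t.1 ++ []).take n = t.1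
    rw [List.append_nil, t.take_val])

theorem val_mul (s t : Trunc A n) : (s * t).1 = (s.1 ++ t.1).take n := rfl

@[simp] theorem val_one : (1 : Trunc A n).1 = [] := rfl

theorem mk_append (l l' : List A) : mk n (l ++ l') = mk n l * mk n l' := ext (by
  rw [val_mul, val_mk, val_mk, val_mk, take_take_append, take_append_take])

theorem mul_of_length_eq {s : Trunc A n} (hs : s.1.length = n) (t : Trunc A n) : s * t = s :=
  ext (by rw [val_mul, List.take_append_of_le_length hs.ge, s.take_val])

instance [Finite A] : Finite (Trunc A n) := (List.finite_length_le A n).to_subtype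

instance : TopologicalSpace (Trunc A n) := ⊥

instance : DiscreteTopology (Trunc A n) := ⟨rfl⟩

instance : SMul A (Trunc A n) := ⟨fun c t => mk n [c] * t⟩

theorem smul_def (c : A) (t : Trunc A n) : c • t = mk n [c] * t := rfl

theorem wordAct_eq (l : List A) (t : Trunc A n) : wordAct l t = mk n l * t := by
  induction l with
  | nil => exact ((congrArg (· * t) (ext (by simp) : mk n [] = (1 : Trunc A n))).trans
      (one_mul t)).symm
  | cons c l ih =>
    rw [wordAct_cons, ih, smul_def, ← mul_assoc, ← mk_append, List.singleton_append]

/-- The nonempty words of length at most `n + 1`. -/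
def pos (A : Type v) (n : ℕ) : Subsemigroup (Trunc A (n + 1)) where
  carrier := {t | t.1 ≠ []}
  mul_mem' {s t} hs _ := by
    intro h
    rw [val_mul, List.take_eq_nil_iff] at h
    simp only [Nat.add_eq_zero_iff, one_ne_zero, and_false, List.append_eq_nil_iff, false_or] at h
    exact hs h.1

end Trunc

/-- Adjoining an identity to a subsemigroup without identity of a monoid. -/
theorem withOne_lift_injective {N : Type u} [Monoid N] {S : Subsemigroup N} (hS : (1 : N) ∉ S) :
    Function.Injective (WithOne.lift (MulMemClass.subtype S)) := by
  intro x y h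
  induction x using WithOne.recOneCoe with
  | one =>
    induction y using WithOne.recOneCoe with
    | one => rfl
    | coe y => exact (hS (by rw [WithOne.lift_coe, map_one] at h; exact h ▸ y.2)).elim
  | coe x =>
    induction y using WithOne.recOneCoe with
    | one => exact (hS (by rw [WithOne.lift_coe, map_one] at h; exact h ▸ x.2)).elim
    | coe y => exact congrArg _ (Subtype.ext (by simpa using h))

/-- A product of `k` nonempty words, truncated at `n + 1`, has length at least `min (n + 1) k`, and
a word of full length leaves no room for further factors. -/
theorem pseudoK_trunc_pos (A : Type) [Finite A] [Nonempty A] (n : ℕ) :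
    pseudoK (Trunc.pos A n) := by
  refine pseudoK_iff.2 ⟨⟨inferInstance, ⟨⟨Trunc.mk _ [Classical.arbitrary A], ?_⟩⟩⟩, n + 1,
    by omega, fun l hl y => ?_⟩
  · change List.take _ _ ≠ []
    simp
  · set κ := WithOne.lift (MulMemClass.subtype (Trunc.pos A n)) with hκ
    have hκi : Function.Injective κ := withOne_lift_injective fun h => h rfl
    have hlen : min (n + 1) l.length ≤ (κ (wordVal id l)).1.length := by
      clear hl
      induction l with
      | nil => simp
      | cons t l ih =>
        have ht : 1 ≤ t.1.1.length := List.length_pos_iff.2 t.2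
        have hκt : κ t = t.1 := WithOne.lift_coe _ _
        rw [wordVal_cons, id, map_mul, hκt, Trunc.val_mul, List.length_take, List.length_append,
          List.length_cons]
        omega
    apply hκi
    rw [map_mul]
    refine Trunc.mul_of_length_eq ?_ _
    have := (κ (wordVal id l)).2
    omega

/-! ## Characterization of `K^u` -/

/-- The first `m ≥ n` letters already absorb the remaining ones. -/
theorem wordAct_take {A : Type v} {U : Type u} [SMul A U] {n : ℕ}
    (h : ∀ w : List A, n ≤ w.length → ∀ (l : List A) (y : U),
      wordAct w (wordAct l y) = wordAct w y) {m : ℕ} (hm : n ≤ m) (l : List A) (y : U) :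
    wordAct (l.take m) y = wordAct l y := by
  rcases le_total l.length m with hl | hl
  · rw [List.take_of_length_le hl]
  · conv_rhs => rw [← List.take_append_drop m l, wordAct_append]
    exact (h _ (by simp; omega) _ _).symm

/-- The members of `K^u` are the finite algebras in which all long enough words absorb everything
on the right. -/
theorem unaryOf_pseudoK_iff {A : Type} [Finite A] [Nonempty A] {U : Type} [SMul A U] :
    unaryOf pseudoK A U ↔ (Finite U ∧ Nonempty U) ∧
      ∃ n : ℕ, ∀ w : List A, n ≤ w.length → ∀ (l : List A) (y : U),
        wordAct w (wordAct l y) = wordAct w y := by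
  refine ⟨fun h => ⟨h.1, exists_absorb_of_unaryOf h⟩, ?_⟩
  rintro ⟨⟨_, _⟩, n, hn⟩
  refine ⟨⟨inferInstance, inferInstance⟩, fun P _ _ ι hP ρ hρ hρι p q hpq => ?_⟩
  have hT := pseudoK_trunc_pos A n
  have := hT.1.2
  obtain ⟨f, ⟨hf, hfι⟩, -⟩ := hP.exists_finite_lift (Trunc.pos A n) hT.1
    fun c => ⟨Trunc.mk _ [c], by change List.take _ _ ≠ []; simp⟩
  -- Truncation at `n + 1` does not alter the action on `U`, so `ρ` factors through a member of `K`,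
  -- where `p` and `q` have the same image.
  let τ : Trunc.pos A n →ₙ* Function.End U := ⟨fun t => wordAct t.1.1, fun s t => funext fun y =>
    (wordAct_take hn n.le_succ _ y).trans (wordAct_append _ _ _)⟩
  have : Finite (Function.End U) := inferInstanceAs (Finite (U → U))
  obtain ⟨ρ', -, hu⟩ := hP.exists_finite_lift (Function.End U)
    ⟨inferInstance, inferInstance⟩ fun c y => c • y
  have hρτ : ρ = τ.comp f := by
    rw [hu ρ ⟨hρ, fun c => funext fun y => hρι c y⟩,
      hu (τ.comp f) ⟨hf.comp τ, fun c => ?_⟩]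
    rw [MulHom.comp_apply, hfι]
    refine funext fun y => ?_
    change wordAct (List.take (n + 1) [c]) y = c • y
    simp
  have hfpq := hpq _ hT f hf
  intro y
  rw [hρτ, MulHom.comp_apply, MulHom.comp_apply, hfpq]

/-- The absorption criterion passes to images and subalgebras with the same bound, and to a finite
product with the largest bound of its factors. -/
theorem isUnaryPseudovariety_unaryOf_pseudoK (A : Type) [Finite A] [Nonempty A] :
    IsUnaryPseudovariety (unaryOf pseudoK A) where
  finite U _ h := h.1
  image U W _ _ hU f hf := by
    obtain ⟨⟨_, ⟨y⟩⟩, n, hn⟩ := unaryOf_pseudoK_iff.1 hU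
    refine unaryOf_pseudoK_iff.2 ⟨⟨Finite.of_surjective f hf, ⟨f y⟩⟩, n, fun w hw l z => ?_⟩
    obtain ⟨y, rfl⟩ := hf z
    rw [← map_wordAct, ← map_wordAct, hn w hw, map_wordAct]
  subalgebra U W _ _ hU hW f hf := by
    obtain ⟨⟨_, _⟩, n, hn⟩ := unaryOf_pseudoK_iff.1 hU
    refine unaryOf_pseudoK_iff.2 ⟨⟨Finite.of_injective f hf, hW⟩, n, fun w hw l z => hf ?_⟩
    rw [map_wordAct, map_wordAct, hn w hw, map_wordAct]
  product J _ U _ hU := by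
    have h := fun j => unaryOf_pseudoK_iff.1 (hU j)
    have h1 (j : J) : Finite (U j) := (h j).1.1
    have h2 (j : J) : Nonempty (U j) := (h j).1.2
    choose n hn using fun j => (h j).2
    have := Fintype.ofFinite J
    refine unaryOf_pseudoK_iff.2 ⟨⟨inferInstance, inferInstance⟩, Finset.univ.sup n,
      fun w hw l z => funext fun j => ?_⟩
    let pr : (∀ j, U j) →[A] U j := ⟨fun z => z j, fun _ _ => rfl⟩
    change pr (wordAct w (wordAct l z)) = pr (wordAct w z)
    rw [map_wordAct, map_wordAct, map_wordAct]
    exact hn j w ((Finset.le_sup (Finset.mem_univ j)).trans hw) l _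

/-! ## Finite and infinite words -/

/-- The compatible sequences of truncated words, that is, the finite and infinite words. -/
def proWordSubmonoid (A : Type v) : Submonoid (∀ n, Trunc A n) where
  carrier := {m | ∀ n, (m (n + 1)).1.take n = (m n).1}
  one_mem' := fun _ => by simp
  mul_mem' {m m'} hm hm' n := by
    rw [Pi.mul_apply, Pi.mul_apply, Trunc.val_mul, Trunc.val_mul, ← hm n, ← hm' n, take_take_append,
      take_append_take, List.take_take, min_eq_left n.le_succ]

/-- The monoid of finite and infinite words, as the inverse limit of the monoids of truncated
words. -/
def ProWord (A : Type v) : Type v := proWordSubmonoid A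

namespace ProWord

variable {A : Type v}

instance : Monoid (ProWord A) := inferInstanceAs (Monoid (proWordSubmonoid A))

instance : TopologicalSpace (ProWord A) := inferInstanceAs (TopologicalSpace (proWordSubmonoid A))

instance : ContinuousMul (ProWord A) := inferInstanceAs (ContinuousMul (proWordSubmonoid A))

instance : T2Space (ProWord A) := inferInstanceAs (T2Space (proWordSubmonoid A))

/-- The truncation to length `n`. -/
def trunc (n : ℕ) : ProWord A →* Trunc A n :=
  (Pi.evalMonoidHom (fun n => Trunc A n) n).comp (proWordSubmonoid A).subtype

/-- The prefix of length `n`. -/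
def pre (m : ProWord A) (n : ℕ) : List A := (trunc n m).1

theorem continuous_trunc (n : ℕ) : Continuous (trunc n : ProWord A → Trunc A n) :=
  (continuous_apply n).comp continuous_subtype_val

theorem isLocallyConstant_trunc (n : ℕ) :
    IsLocallyConstant (trunc n : ProWord A → Trunc A n) :=
  (IsLocallyConstant.iff_continuous _).2 (continuous_trunc n)

theorem ext {m m' : ProWord A} (h : ∀ n, m.pre n = m'.pre n) : m = m' :=
  Subtype.ext (funext fun n => Trunc.ext (h n))

theorem length_pre_le (m : ProWord A) (n : ℕ) : (m.pre n).length ≤ n := (trunc n m).2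

theorem take_pre (m : ProWord A) {k n : ℕ} (h : k ≤ n) : (m.pre n).take k = m.pre k := by
  induction n, h using Nat.le_induction with
  | base => exact Trunc.take_val _
  | succ n hn ih =>
    rw [← ih, ← show (m.pre (n + 1)).take n = m.pre n from m.2 n, List.take_take, min_eq_left hn]

@[simp] theorem pre_one (n : ℕ) : (1 : ProWord A).pre n = [] := rfl

theorem pre_mul (m m' : ProWord A) (n : ℕ) : (m * m').pre n = (m.pre n ++ m'.pre n).take n := rfl

instance [Finite A] : CompactSpace (ProWord A) := by
  have : IsClosed (proWordSubmonoid A : Set (∀ n, Trunc A n)) := by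
    have : (proWordSubmonoid A : Set (∀ n, Trunc A n)) =
        ⋂ n, (fun m => (m (n + 1), m n)) ⁻¹' {p | p.1.1.take n = p.2.1} := by
      ext m
      simp [proWordSubmonoid]
    rw [this]
    refine isClosed_iInter fun n => (isClosed_discrete _).preimage ?_
    exact (continuous_apply _).prodMk (continuous_apply _)
  exact isCompact_iff_compactSpace.1 this.isCompact

/-- The finite words. -/
def ofList (l : List A) : ProWord A := ⟨fun n => Trunc.mk n l, fun n => by
  rw [Trunc.val_mk, Trunc.val_mk, List.take_take, min_eq_left n.le_succ]⟩

/-- The infinite words. -/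
def ofFun (s : ℕ → A) : ProWord A := ⟨fun n => ⟨(List.range n).map s, by simp⟩, fun n => by
  simp [← List.map_take, List.take_range]⟩

@[simp] theorem pre_ofList (l : List A) (n : ℕ) : (ofList l).pre n = l.take n := rfl

@[simp] theorem pre_ofFun (s : ℕ → A) (n : ℕ) : (ofFun s).pre n = (List.range n).map s := rfl

@[simp] theorem ofList_nil : ofList ([] : List A) = 1 := ext fun n => by simp

theorem ofList_append (l l' : List A) : ofList (l ++ l') = ofList l * ofList l' :=
  ext fun n => congrArg Subtype.val (Trunc.mk_append (n := n) l l')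

theorem ofList_cons (c : A) (l : List A) : ofList (c :: l) = ofList [c] * ofList l :=
  ofList_append [c] l

theorem tendsto_iff {α : Type*} {F : Filter α} {x : α → ProWord A} {m : ProWord A} :
    Tendsto x F (𝓝 m) ↔ ∀ n, ∀ᶠ k in F, (x k).pre n = m.pre n := by
  refine (tendsto_subtype_rng (p := (· ∈ proWordSubmonoid A))).trans (tendsto_pi_nhds.trans ?_)
  refine forall_congr' fun n => ?_
  rw [nhds_discrete, tendsto_pure]
  exact eventually_congr (Eventually.of_forall fun k => Subtype.ext_iff)

theorem tendsto_ofList_pre (m : ProWord A) :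
    Tendsto (fun k => ofList (m.pre k)) atTop (𝓝 m) :=
  tendsto_iff.2 fun n => (eventually_ge_atTop n).mono fun _ hk => m.take_pre hk

theorem denseRange_ofList : DenseRange (ofList : List A → ProWord A) := fun m =>
  mem_closure_of_tendsto (tendsto_ofList_pre m) (Eventually.of_forall fun _ => ⟨_, rfl⟩)

theorem eq_one_iff {m : ProWord A} : m = 1 ↔ m.pre 1 = [] := by
  refine ⟨fun h => h ▸ rfl, fun h => ext fun n => ?_⟩
  cases n with
  | zero => exact List.eq_nil_of_length_eq_zero (Nat.le_zero.1 (m.length_pre_le 0))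
  | succ n =>
    rw [← m.take_pre (show 1 ≤ n + 1 by omega), List.take_eq_nil_iff] at h
    simpa using h

theorem ofList_ne_one {l : List A} (hl : l ≠ []) : ofList l ≠ 1 := by
  rw [Ne, eq_one_iff, pre_ofList, List.take_eq_nil_iff]
  simpa using hl

theorem ofFun_mul (s : ℕ → A) (m : ProWord A) : ofFun s * m = ofFun s := ext fun n => by
  rw [pre_mul, pre_ofFun, List.take_append_of_le_length (by simp), List.take_of_length_le (by simp)]

theorem ofFun_eq_cons (s : ℕ → A) :
    ofFun s = ofList [s 0] * ofFun (fun n => s (n + 1)) := ext fun k => by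
  have h : [s 0] ++ (List.range k).map (fun n => s (n + 1)) = (List.range (k + 1)).map s := by
    rw [List.range_succ_eq_map, List.map_cons, List.map_map]
    rfl
  rw [pre_mul, pre_ofList, pre_ofFun, pre_ofFun, take_take_append, h, ← List.map_take,
    List.take_range, min_eq_left k.le_succ]

/-- Every element is a finite or an infinite word. -/
theorem eq_ofList_or_eq_ofFun (m : ProWord A) : (∃ l, m = ofList l) ∨ ∃ s, m = ofFun s := by
  -- Either all prefixes have full length and the letters can be read off, or some prefix falls
  -- short and is the whole word.
  by_cases h : ∀ n, (m.pre n).length = n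
  · right
    refine ⟨fun n => (m.pre (n + 1))[n]'(by rw [h]; omega), ext fun n => ?_⟩
    refine List.ext_getElem (by simp [h]) fun i hi _ => ?_
    have hin : i + 1 ≤ n := by rw [h] at hi; omega
    simp [← m.take_pre hin]
  · left
    push Not at h
    obtain ⟨n, hn⟩ := h
    have hn : (m.pre n).length < n := lt_of_le_of_ne (m.length_pre_le n) hn
    refine ⟨m.pre n, ext fun k => ?_⟩
    rw [pre_ofList]
    rcases le_total k n with hk | hk
    · exact (m.take_pre hk).symm
    · have h1 := m.take_pre hk
      rw [List.take_of_length_le (by omega), ← h1]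
      refine (List.take_of_length_le ?_).symm
      have := congrArg List.length h1
      rw [List.length_take] at this
      omega

/-! ### The free pro-`K` semigroup -/

/-- The nonempty words. -/
def pos (A : Type v) : Subsemigroup (ProWord A) where
  carrier := {m | m ≠ 1}
  mul_mem' {m m'} hm _ h := hm (by
    rw [eq_one_iff, pre_mul, List.take_eq_nil_iff] at h
    rw [eq_one_iff]
    simp only [one_ne_zero, List.append_eq_nil_iff, false_or] at h
    exact h.1)

/-- Being empty is visible in the truncation to length one. This makes the set of nonempty words
compact. -/
theorem isClopen_one : IsClopen {(1 : ProWord A)} := by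
  have : {(1 : ProWord A)} = trunc 1 ⁻¹' {1} := by
    ext m
    exact ⟨fun h => Trunc.ext (eq_one_iff.1 h), fun h => eq_one_iff.2 (congrArg Subtype.val h)⟩
  rw [this]
  exact (isClopen_discrete _).preimage (continuous_trunc 1)

/-- The one-letter words. -/
def letter (c : A) : pos A := ⟨ofList [c], ofList_ne_one (by simp)⟩

/-- The truncation of nonempty words. -/
def truncPos (n : ℕ) : pos A →ₙ* Trunc.pos A n where
  toFun m := ⟨trunc (n + 1) m.1, fun h => m.2 (by
    rw [eq_one_iff, ← m.1.take_pre (show 1 ≤ n + 1 by omega)]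
    exact congrArg (List.take 1) h)⟩
  map_mul' m m' := Subtype.ext (map_mul (trunc (n + 1)) m.1 m'.1)

theorem coe_lift_letter (s : FreeSemigroup A) :
    (FreeSemigroup.lift letter s : ProWord A) = ofList (s.head :: s.tail) := by
  induction s using FreeSemigroup.recOnMul with
  | ih1 c => rfl
  | ih2 c s _ ih => rw [map_mul, MulMemClass.coe_mul, ih]; exact (ofList_append [c] _).symm

theorem denseRange_lift_letter :
    DenseRange (FreeSemigroup.lift (letter : A → pos A)) := by
  intro m
  rw [closure_subtype]
  refine mem_closure_of_tendsto (tendsto_ofList_pre m.1) ?_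
  refine (eventually_ge_atTop 1).mono fun k hk => ?_
  have hne : m.1.pre k ≠ [] := fun h => m.2 (by
    rw [eq_one_iff, ← m.1.take_pre hk, h, List.take_nil])
  obtain ⟨c, l, hcl⟩ := List.exists_cons_of_ne_nil hne
  exact ⟨_, ⟨⟨c, l⟩, rfl⟩, by rw [coe_lift_letter, hcl]⟩

theorem wordVal_take {T : Type u} [Semigroup T] {n : ℕ}
    (hn : ∀ l : List T, n ≤ l.length → ∀ y : WithOne T, wordVal id l * y = wordVal id l)
    (g : A → T) (l : List A) : wordVal g (l.take n) = wordVal g l := by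
  rcases le_total l.length n with hl | hl
  · rw [List.take_of_length_le hl]
  · conv_rhs => rw [← List.take_append_drop n l, wordVal_append]
    have := hn ((l.take n).map g) (by simpa using hl) (wordVal g (l.drop n))
    rw [wordVal_map] at this
    exact this.symm

/-- An assignment of the letters in a member of `K` extends to all nonempty words. -/
theorem exists_lift_pseudoK {A T : Type} [Semigroup T] (hT : pseudoK T) (g : A → T) :
    ∃ f : pos A →ₙ* T, IsLocallyConstant f ∧ ∀ c, f (letter c) = g c := by
  obtain ⟨-, n, hn1, hn⟩ := pseudoK_iff.1 hT
  -- Since `n ≥ 1`, the prefix of a nonempty word is nonempty, so its value lies in `T` and is not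
  -- the adjoined identity.
  have hex (m : pos A) : ∃ t : T, (t : WithOne T) = wordVal g (m.1.pre n) := by
    have hne : m.1.pre n ≠ [] := fun h => m.2 (by
      rw [eq_one_iff, ← m.1.take_pre hn1, h, List.take_nil])
    obtain ⟨c, l, hcl⟩ := List.exists_cons_of_ne_nil hne
    rw [hcl, wordVal_cons]
    induction wordVal g l using WithOne.recOneCoe with
    | one => exact ⟨g c, (mul_one _).symm⟩
    | coe t => exact ⟨g c * t, rfl⟩
  choose f hf using hex
  refine ⟨⟨f, fun m m' => ?_⟩, ?_, fun c => ?_⟩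
  · rw [← WithOne.coe_inj, WithOne.coe_mul, hf, hf, hf, MulMemClass.coe_mul, pre_mul,
      wordVal_take hn, wordVal_append]
  · refine IsLocallyConstant.desc (α := T) (β := WithOne T) _ (fun t => (t : WithOne T)) ?_
      WithOne.coe_injective
    have : (fun t : T => (t : WithOne T)) ∘ f =
        (fun t : Trunc A n => wordVal g t.1) ∘ fun m : pos A => trunc n m.1 := funext hf
    exact this ▸ ((isLocallyConstant_trunc n).comp_continuous continuous_subtype_val).comp _
  · change f (letter c) = g c
    rw [← WithOne.coe_inj, hf]
    change wordVal g (List.take n [c]) = _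
    rw [wordVal_take hn]
    simp

theorem isProSemigroup_pos (A : Type) [Finite A] [Nonempty A] : IsProSemigroup pseudoK (pos A) where
  nonempty := ⟨letter (Classical.arbitrary A)⟩
  continuous_mul := inferInstance
  compact := isCompact_iff_compactSpace.1 (isClopen_one.compl.1.isCompact :
    IsCompact ({1}ᶜ : Set (ProWord A)))
  t2 := inferInstance
  separated s t hst := by
    obtain ⟨n, hn⟩ : ∃ n, s.1.pre n ≠ t.1.pre n := by
      by_contra h
      push Not at h
      exact hst (Subtype.ext (ext h))
    refine ⟨Trunc.pos A n, _, pseudoK_trunc_pos A n, truncPos n, ?_, fun h => hn ?_⟩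
    · exact ((isLocallyConstant_trunc (n + 1)).comp_continuous continuous_subtype_val).desc
        (truncPos n) Subtype.val Subtype.val_injective
    · have h1 : s.1.pre (n + 1) = t.1.pre (n + 1) :=
        congrArg (fun x : Trunc.pos A n => x.1.1) h
      rw [← s.1.take_pre n.le_succ, h1, t.1.take_pre n.le_succ]

theorem isFreeProSemigroup_pos (A : Type) [Finite A] [Nonempty A] :
    IsFreeProSemigroup.{0, w} pseudoK (letter : A → pos A) :=
  (isProSemigroup_pos A).isFree denseRange_lift_letter fun _ _ hT g => exists_lift_pseudoK hT g

/-! ### The free pro-`K^u` algebra over one generator -/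

instance : SMul A (ProWord A) := ⟨fun c m => ofList [c] * m⟩

theorem smul_def (c : A) (m : ProWord A) : c • m = ofList [c] * m := rfl

theorem wordAct_eq (l : List A) (m : ProWord A) : wordAct l m = ofList l * m := by
  induction l with
  | nil => simp
  | cons c l ih => rw [wordAct_cons, ih, smul_def, ← mul_assoc, ← ofList_cons]

theorem unaryOf_trunc (A : Type) [Finite A] [Nonempty A] (n : ℕ) :
    unaryOf pseudoK A (Trunc A n) := by
  refine unaryOf_pseudoK_iff.2 ⟨⟨inferInstance, ⟨1⟩⟩, n, fun w hw l t => ?_⟩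
  have h : (Trunc.mk n w).1.length = n := by simpa using hw
  rw [Trunc.wordAct_eq w, Trunc.wordAct_eq w, Trunc.mul_of_length_eq h, Trunc.mul_of_length_eq h]

theorem isProUnary (A : Type) [Finite A] [Nonempty A] :
    IsProUnary (unaryOf pseudoK A) (ProWord A) where
  nonempty := ⟨1⟩
  continuous_smul := ⟨fun _ => continuous_const_mul _⟩
  compact := inferInstance
  t2 := inferInstance
  separated s t hst := by
    obtain ⟨n, hn⟩ : ∃ n, s.pre n ≠ t.pre n := by
      by_contra h
      push Not at h
      exact hst (ext h)
    exact ⟨Trunc A n, _, unaryOf_trunc A n, ⟨trunc n, fun c m => map_mul _ _ _⟩,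
      isLocallyConstant_trunc n, fun h => hn (congrArg Subtype.val h)⟩

theorem isFreeProUnary (A : Type) [Finite A] [Nonempty A] :
    IsFreeProUnary.{0, w} (unaryOf pseudoK A) (1 : ProWord A) := by
  refine (isProUnary A).isFree ?_ fun U _ hU y => ?_
  · have : (fun l : List A => wordAct l (1 : ProWord A)) = ofList := by
      funext l
      rw [wordAct_eq, mul_one]
    exact this ▸ denseRange_ofList
  · obtain ⟨-, n, hn⟩ := unaryOf_pseudoK_iff.1 hU
    -- Reading only the prefix of length `n` suffices, as `n` letters absorb the rest in `U`.
    refine ⟨⟨fun m => wordAct (m.pre n) y, fun c m => ?_⟩,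
      (isLocallyConstant_trunc n).comp fun t => wordAct t.1 y, rfl⟩
    rw [id, smul_def, pre_mul, wordAct_take hn le_rfl, wordAct_append, pre_ofList,
      wordAct_take hn le_rfl]
    rfl

/-! ### Uniqueness of the free objects -/

/-- Every free pro-`K` semigroup with an adjoined identity is the monoid of words. -/
theorem exists_homeomorph_withOne {A : Type} [Finite A] [Nonempty A] {P : Type u} [Semigroup P]
    [TopologicalSpace P] {ι : A → P} (hP : IsFreeProSemigroup.{u, w} pseudoK ι) :
    ∃ E : WithOne P ≃ₜ ProWord A, E 1 = 1 ∧ (∀ x y, E (x * y) = E x * E y) ∧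
      ∀ c, E (ι c) = ofList [c] := by
  have hPc := hP.isPro.compact
  obtain ⟨f, ⟨hf, hfι⟩, -⟩ := hP.exists_lift (pos A) (isProSemigroup_pos A) letter
  -- By uniqueness of extensions, every continuous homomorphism from `P` into a member of `K`
  -- factors through `f`, and such homomorphisms separate points.
  have hinj : Function.Injective f := by
    intro s t hst
    by_contra hne
    obtain ⟨T, _, hT, h, hh, hne⟩ := hP.isPro.separated s t hne
    have := hT.1.1
    have := hT.1.2
    obtain ⟨k, hk, hkι⟩ := exists_lift_pseudoK hT (h ∘ ι)
    obtain ⟨h', -, hu⟩ := hP.exists_finite_lift T hT (h ∘ ι)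
    have : h = k.comp f := by
      rw [hu h ⟨hh, fun _ => rfl⟩, hu (k.comp f) ⟨hk.comp_continuous hf, fun c => ?_⟩]
      rw [MulHom.comp_apply, hfι, hkι]
    exact hne (by rw [this, MulHom.comp_apply, MulHom.comp_apply, hst])
  have hsurj : Function.Surjective f := by
    have hcl : IsClosed (Set.range f) := (isCompact_range hf).isClosed
    rw [← Set.range_eq_univ, ← Set.univ_subset_iff, ← denseRange_lift_letter.closure_range]
    refine closure_minimal ?_ hcl
    rintro _ ⟨s, rfl⟩
    refine ⟨FreeSemigroup.lift ι s, ?_⟩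
    rw [← MulHom.comp_apply]
    exact congrFun (congrArg DFunLike.coe (FreeSemigroup.hom_ext
      (f := f.comp (FreeSemigroup.lift ι)) (g := FreeSemigroup.lift letter)
      (funext fun c => hfι c))) s
  let e : WithOne P →* ProWord A := WithOne.lift ((MulMemClass.subtype (pos A)).comp f)
  have he (p : P) : e p = (f p).1 := WithOne.lift_coe _ _
  have hec : Continuous e := continuous_coinduced_dom.2 (continuous_subtype_val.comp hf)
  have heb : Function.Bijective e := by
    constructor
    · have : e = (WithOne.lift (MulMemClass.subtype (pos A))).comp (WithOne.mapMulHom f) := by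
        refine MonoidHom.ext fun p => ?_
        induction p using WithOne.recOneCoe with
        | one => simp
        | coe p => simp [he]
      rw [this]
      exact (withOne_lift_injective fun h : 1 ∈ pos A => h rfl).comp (WithOne.mapMulHom_injective hinj)
    · intro m
      by_cases hm : m = 1
      · exact ⟨1, by rw [map_one, hm]⟩
      · obtain ⟨p, hp⟩ := hsurj ⟨m, hm⟩
        exact ⟨p, by rw [he, hp]⟩
  -- A continuous bijection from a compact space to a Hausdorff space is a homeomorphism.
  have : CompactSpace (WithOne P) := by
    refine ⟨?_⟩
    have : (Set.univ : Set (WithOne P)) = Set.range (fun p : P => (p : WithOne P)) ∪ {1} := by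
      refine (Set.eq_univ_of_forall fun x => ?_).symm
      induction x using WithOne.recOneCoe with
      | one => exact Or.inr rfl
      | coe p => exact Or.inl ⟨p, rfl⟩
    rw [this]
    exact (isCompact_range continuous_coinduced_rng).union isCompact_singleton
  refine ⟨Continuous.homeoOfEquivCompactToT2 (f := Equiv.ofBijective e heb) hec, map_one e,
    map_mul e, fun c => ?_⟩
  exact (he _).trans (congrArg Subtype.val (hfι c))

/-- Every free pro-`K^u` algebra over one generator is the monoid of words. -/
theorem exists_homeomorph_unary {A : Type} [Finite A] [Nonempty A] {F : Type u} [SMul A F]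
    [TopologicalSpace F] {x : F} (hF : IsFreeProUnary.{u, w} (unaryOf pseudoK A) x) :
    ∃ G : F ≃ₜ ProWord A, G x = 1 ∧ ∀ (c : A) y, G (c • y) = ofList [c] * G y := by
  have hFc := hF.isPro.compact
  obtain ⟨f, ⟨hf, hfx⟩, -⟩ := hF.exists_lift (ProWord A) (isProUnary A) 1
  have hinj : Function.Injective f := by
    intro s t hst
    by_contra hne
    obtain ⟨T, _, hT, h, hh, hne⟩ := hF.isPro.separated s t hne
    have := hT.1.1
    have := hT.1.2
    obtain ⟨k, ⟨hk, hkx⟩, -⟩ := (isFreeProUnary.{0} A).exists_finite_lift T hT (h x)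
    obtain ⟨h', -, hu⟩ := hF.exists_finite_lift T hT (h x)
    have : h = k.comp f := by
      rw [hu h ⟨hh, rfl⟩, hu (k.comp f) ⟨hk.comp_continuous hf, ?_⟩]
      rw [MulActionHom.comp_apply, hfx, hkx]
    exact hne (by rw [this, MulActionHom.comp_apply, MulActionHom.comp_apply, hst])
  have hsurj : Function.Surjective f := by
    have hcl : IsClosed (Set.range f) := (isCompact_range hf).isClosed
    rw [← Set.range_eq_univ, ← Set.univ_subset_iff, ← denseRange_ofList.closure_range]
    refine closure_minimal ?_ hcl
    rintro _ ⟨l, rfl⟩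
    exact ⟨wordAct l x, by rw [map_wordAct, hfx, wordAct_eq, mul_one]⟩
  exact ⟨Continuous.homeoOfEquivCompactToT2 (f := Equiv.ofBijective f ⟨hinj, hsurj⟩) hf, hfx,
    fun c y => map_smul f c y⟩

end ProWord

instance : Finite Letter :=
  Finite.of_injective (fun c : Letter => c.digit) (by rintro (_ | _) (_ | _) <;> simp [Letter.digit])

instance : Nonempty Letter := ⟨Letter.a⟩

namespace ProWord

/-! ## The Cantor function on finite and infinite words -/

section letterAt

variable {A : Type v}

/-- The letter at a given position, if there is one. -/
def letterAt (m : ProWord A) (n : ℕ) : Option A := (m.pre (n + 1))[n]?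

theorem letterAt_cons_zero (c : A) (m : ProWord A) : (ofList [c] * m).letterAt 0 = some c := by
  simp [letterAt, pre_mul]

theorem letterAt_cons_succ (c : A) (m : ProWord A) (n : ℕ) :
    (ofList [c] * m).letterAt (n + 1) = m.letterAt n := by
  have h : (ofList [c] * m).pre (n + 2) = c :: m.pre (n + 1) := by
    rw [pre_mul, pre_ofList, take_take_append, List.singleton_append, List.take_succ_cons,
      m.take_pre (by omega)]
  rw [letterAt, h, List.getElem?_cons_succ, letterAt]

theorem letterAt_ofFun (s : ℕ → A) (n : ℕ) : (ofFun s).letterAt n = some (s n) := by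
  simp [letterAt]

theorem isLocallyConstant_letterAt (n : ℕ) :
    IsLocallyConstant fun m : ProWord A => m.letterAt n :=
  (isLocallyConstant_trunc (n + 1)).comp fun t => t.1[n]?

/-- The real number whose `n`-th binary digit depends on the letter at position `n`. -/
noncomputable def binary (d : Option A → Fin 2) (m : ProWord A) : ℝ :=
  Real.ofDigits fun n => d (m.letterAt n)

theorem ofDigits_two_eq (x : ℕ → Fin 2) :
    Real.ofDigits x = ((x 0 : ℕ) + Real.ofDigits fun n => x (n + 1)) / 2 := by
  rw [Real.ofDigits_eq_sum_add_ofDigits x 1]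
  simp [Real.ofDigitsTerm]
  ring

theorem continuous_binary (d : Option A → Fin 2) : Continuous (binary d) := by
  refine Real.continuous_ofDigits.comp (continuous_pi fun n => ?_)
  exact ((isLocallyConstant_letterAt n).comp d).continuous

theorem binary_cons (d : Option A → Fin 2) (c : A) (m : ProWord A) :
    binary d (ofList [c] * m) = ((d (some c) : ℕ) + binary d m) / 2 := by
  rw [binary, ofDigits_two_eq, letterAt_cons_zero]
  simp only [letterAt_cons_succ]
  rfl

end letterAt

/-- The value of a word as a binary expansion. -/
noncomputable def value : ProWord Letter → ℝ := binary fun o => o.elim 0 Letter.digit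

/-- The number `2⁻ⁿ` for a word of length `n`, and zero for an infinite word. -/
noncomputable def gap : ProWord Letter → ℝ := binary fun o => o.elim 1 fun _ => 0

/-- The value together with the gap. -/
noncomputable def cantor (m : ProWord Letter) : ℝ × ℝ := (value m, gap m)

theorem continuous_cantor : Continuous cantor :=
  (continuous_binary _).prodMk (continuous_binary _)

theorem value_cons (c : Letter) (m : ProWord Letter) :
    value (ofList [c] * m) = ((c.digit : ℕ) + value m) / 2 := binary_cons _ _ _

theorem gap_cons (c : Letter) (m : ProWord Letter) : gap (ofList [c] * m) = gap m / 2 := by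
  refine (binary_cons _ c m).trans ?_
  rw [Option.elim_some, Fin.val_zero, Nat.cast_zero, zero_add]
  rfl

theorem ofDigits_zero {b : ℕ} [NeZero b] : Real.ofDigits (fun _ => (0 : Fin b)) = 0 := by
  simp [Real.ofDigits, Real.ofDigitsTerm]

theorem value_nonneg (m : ProWord Letter) : 0 ≤ value m := Real.ofDigits_nonneg _

theorem value_le_one (m : ProWord Letter) : value m ≤ 1 := Real.ofDigits_le_one _

theorem gap_one : gap 1 = 1 := Real.ofDigits_const_last_eq_one 1

theorem value_one : value 1 = 0 := ofDigits_zero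

theorem value_ofFun (s : ℕ → Letter) : value (ofFun s) = Real.ofDigits fun n => (s n).digit := by
  simp [value, binary, letterAt_ofFun]

theorem gap_ofFun (s : ℕ → Letter) : gap (ofFun s) = 0 := by
  simp [gap, binary, letterAt_ofFun, ofDigits_zero]

/-- A finite word stands for the dyadic interval from its value to value plus gap; prefixing a
letter maps this interval into one half of `[0,1]`. In particular the value stays strictly below
one. -/
theorem gap_ofList (l : List Letter) : 0 < gap (ofList l) ∧ value (ofList l) + gap (ofList l) ≤ 1 := by
  induction l with
  | nil => simp [gap_one, value_one]
  | cons c l ih =>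
    rw [ofList_cons, gap_cons, value_cons]
    refine ⟨by linarith [ih.1], ?_⟩
    cases c <;> simp [Letter.digit] <;> linarith [ih.1, ih.2]

/-- The gap singles out the empty word. Since values of finite words are below one, the half of
`[0,1)` containing the value decides the first letter, which is then stripped. -/
theorem cantor_ofList_injective : Function.Injective fun l => cantor (ofList l) := by
  intro l l' h
  simp only [cantor, Prod.mk.injEq] at h
  induction l generalizing l' with
  | nil =>
    cases l' with
    | nil => rfl
    | cons c l' =>
      rw [ofList_cons, gap_cons, ofList_nil, gap_one] at h
      linarith [h.2, (gap_ofList l').2, value_nonneg (ofList l')]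
  | cons c l ih =>
    cases l' with
    | nil =>
      rw [ofList_cons, gap_cons, ofList_nil, gap_one] at h
      linarith [h.2, (gap_ofList l).2, value_nonneg (ofList l)]
    | cons c' l' =>
      rw [ofList_cons, ofList_cons c', gap_cons, gap_cons, value_cons, value_cons] at h
      have h1 := gap_ofList l
      have h2 := gap_ofList l'
      have h3 := value_nonneg (ofList l)
      have h4 := value_nonneg (ofList l')
      have hc : c = c' := by
        cases c <;> cases c' <;> simp [Letter.digit] at h ⊢ <;> linarith [h.1]
      subst hc
      rw [@ih l' ⟨by linarith [h.1], by linarith [h.2]⟩]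

/-- A positive gap excludes infinite words. -/
theorem eq_ofList_of_cantor_eq {m : ProWord Letter} {l : List Letter}
    (h : cantor m = cantor (ofList l)) : m = ofList l := by
  rcases m.eq_ofList_or_eq_ofFun with ⟨l', rfl⟩ | ⟨s, rfl⟩
  · rw [cantor_ofList_injective h]
  · have h2 : gap (ofFun s) = gap (ofList l) := congrArg Prod.snd h
    rw [gap_ofFun] at h2
    exact absurd h2 (gap_ofList l).1.ne

/-- Finite left factors must coincide, and prefixing a letter acts on value and gap by an affine
map. Infinite left factors absorb the right ones. -/
theorem cantor_mul_congr {m m' n n' : ProWord Letter} (h : cantor m = cantor m')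
    (hn : cantor n = cantor n') : cantor (m * n) = cantor (m' * n') := by
  rcases m'.eq_ofList_or_eq_ofFun with ⟨l, rfl⟩ | ⟨s', rfl⟩
  · rw [eq_ofList_of_cantor_eq h]
    clear h
    induction l with
    | nil => simpa using hn
    | cons c l ih =>
      simp only [cantor, Prod.mk.injEq] at ih ⊢
      rw [ofList_cons, mul_assoc, mul_assoc, value_cons, value_cons, gap_cons, gap_cons, ih.1, ih.2]
      exact ⟨rfl, rfl⟩
  · rcases m.eq_ofList_or_eq_ofFun with ⟨l, rfl⟩ | ⟨s, rfl⟩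
    · exact absurd (congrArg Prod.snd h) (by
        change gap _ ≠ gap _
        rw [gap_ofFun]
        exact (gap_ofList l).1.ne')
    · rwa [ofFun_mul, ofFun_mul]

/-! ### The fibres of the Cantor function -/

/-- The pairs of words `w a b b b ⋯` and `w b a a a ⋯`. -/
def DyadicPair (m m' : ProWord Letter) : Prop :=
  ∃ w : List Letter, m = ofList w * (ofList [Letter.a] * ofFun fun _ => Letter.b) ∧
    m' = ofList w * (ofList [Letter.b] * ofFun fun _ => Letter.a)

theorem value_const_a : value (ofFun fun _ => Letter.a) = 0 := by
  rw [value_ofFun]; exact ofDigits_zero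

theorem value_const_b : value (ofFun fun _ => Letter.b) = 1 := by
  rw [value_ofFun]; exact Real.ofDigits_const_last_eq_one 1

theorem DyadicPair.cantor_eq {m m' : ProWord Letter} (h : DyadicPair m m') :
    cantor m = cantor m' := by
  obtain ⟨w, rfl, rfl⟩ := h
  refine cantor_mul_congr rfl (Prod.ext ?_ ?_)
  · simp [cantor, value_cons, value_const_a, value_const_b, Letter.digit]
  · simp [cantor, gap_cons, gap_ofFun]

theorem DyadicPair.cons {m m' : ProWord Letter} (h : DyadicPair m m') (c : Letter) :
    DyadicPair (ofList [c] * m) (ofList [c] * m') := by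
  obtain ⟨w, rfl, rfl⟩ := h
  exact ⟨c :: w, by rw [ofList_cons c w, mul_assoc], by rw [ofList_cons c w, mul_assoc]⟩

/-- The first digit and the value of the tail are nonnegative, so both vanish and the argument
repeats on the tail. -/
theorem eq_const_of_value_eq_zero {s : ℕ → Letter} (h : value (ofFun s) = 0) (n : ℕ) :
    s n = Letter.a := by
  induction n generalizing s with
  | zero =>
    have := value_nonneg (ofFun fun n => s (n + 1))
    rw [ofFun_eq_cons, value_cons] at h
    cases hs : s 0 with
    | a => rfl
    | b => rw [hs] at h; simp [Letter.digit] at h; linarith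
  | succ n ih =>
    refine ih (s := fun n => s (n + 1)) ?_
    have := value_nonneg (ofFun fun n => s (n + 1))
    rw [ofFun_eq_cons, value_cons] at h
    have h0 : (0 : ℝ) ≤ ((s 0).digit : ℕ) := Nat.cast_nonneg _
    linarith

theorem eq_const_of_value_eq_one {s : ℕ → Letter} (h : value (ofFun s) = 1) (n : ℕ) :
    s n = Letter.b := by
  induction n generalizing s with
  | zero =>
    have := value_le_one (ofFun fun n => s (n + 1))
    rw [ofFun_eq_cons, value_cons] at h
    cases hs : s 0 with
    | b => rfl
    | a => rw [hs] at h; simp [Letter.digit] at h; linarith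
  | succ n ih =>
    refine ih (s := fun n => s (n + 1)) ?_
    have := value_le_one (ofFun fun n => s (n + 1))
    rw [ofFun_eq_cons, value_cons] at h
    have h0 : (((s 0).digit : ℕ) : ℝ) ≤ 1 := by exact_mod_cast Nat.le_of_lt_succ (s 0).digit.2
    linarith

/-- A word starting with `a` has value at most `1/2`, one starting with `b` at least `1/2`. Equality
forces the tails to have values one and zero. -/
theorem dyadicPair_of_head {s s' : ℕ → Letter} (ha : s 0 = Letter.a) (hb : s' 0 = Letter.b)
    (h : value (ofFun s) = value (ofFun s')) : DyadicPair (ofFun s) (ofFun s') := by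
  have h1 := value_le_one (ofFun fun n => s (n + 1))
  have h2 := value_nonneg (ofFun fun n => s' (n + 1))
  rw [ofFun_eq_cons s, ofFun_eq_cons s', value_cons, value_cons, ha, hb] at h
  simp only [Letter.digit, Fin.val_zero, Fin.val_one, Nat.cast_zero, Nat.cast_one] at h
  have h3 := eq_const_of_value_eq_one (s := fun n => s (n + 1)) (by linarith)
  have h4 := eq_const_of_value_eq_zero (s := fun n => s' (n + 1)) (by linarith)
  refine ⟨[], ?_, ?_⟩
  · rw [ofFun_eq_cons s, ha, funext h3, ofList_nil, one_mul]
  · rw [ofFun_eq_cons s', hb, funext h4, ofList_nil, one_mul]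

/-- Position `n` need not be the first difference: common heads are stripped until the words
disagree at the head. -/
theorem dyadicPair_of_value_eq {s s' : ℕ → Letter} (h : value (ofFun s) = value (ofFun s')) {n : ℕ}
    (hn : s n ≠ s' n) :
    DyadicPair (ofFun s) (ofFun s') ∨ DyadicPair (ofFun s') (ofFun s) := by
  induction n generalizing s s' with
  | zero =>
    cases hs : s 0 <;> cases hs' : s' 0
    · exact absurd (hs.trans hs'.symm) hn
    · exact Or.inl (dyadicPair_of_head hs hs' h)
    · exact Or.inr (dyadicPair_of_head hs' hs h.symm)
    · exact absurd (hs.trans hs'.symm) hn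
  | succ n ih =>
    by_cases h0 : s 0 = s' 0
    · have hv : value (ofFun fun n => s (n + 1)) = value (ofFun fun n => s' (n + 1)) := by
        rw [ofFun_eq_cons s, ofFun_eq_cons s', value_cons, value_cons, h0] at h
        linarith
      rw [ofFun_eq_cons s, ofFun_eq_cons s', h0]
      exact (ih hv hn).imp (fun h => h.cons _) fun h => h.cons _
    · cases hs : s 0 <;> cases hs' : s' 0
      · exact absurd (hs.trans hs'.symm) h0
      · exact Or.inl (dyadicPair_of_head hs hs' h)
      · exact Or.inr (dyadicPair_of_head hs' hs h.symm)
      · exact absurd (hs.trans hs'.symm) h0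

theorem cantor_eq_iff {m m' : ProWord Letter} :
    cantor m = cantor m' ↔ m = m' ∨ DyadicPair m m' ∨ DyadicPair m' m := by
  refine ⟨fun h => ?_, ?_⟩
  · rcases m'.eq_ofList_or_eq_ofFun with ⟨l, rfl⟩ | ⟨s', rfl⟩
    · exact Or.inl (eq_ofList_of_cantor_eq h)
    rcases m.eq_ofList_or_eq_ofFun with ⟨l, rfl⟩ | ⟨s, rfl⟩
    · exact Or.inl (eq_ofList_of_cantor_eq h.symm).symm
    by_cases hs : s = s'
    · exact Or.inl (hs ▸ rfl)
    · obtain ⟨n, hn⟩ := Function.ne_iff.1 hs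
      exact Or.inr (dyadicPair_of_value_eq (congrArg Prod.fst h) hn)
  · rintro (rfl | h | h)
    exacts [rfl, h.cantor_eq, h.cantor_eq.symm]

/-! ## The congruence of the Cantor function -/

theorem ofFun_ne_one {A : Type v} (s : ℕ → A) : ofFun s ≠ 1 := by
  rw [Ne, eq_one_iff]
  simp

theorem exists_coe_of_ne_one {P : Type v} [TopologicalSpace P] {E : WithOne P ≃ₜ ProWord Letter}
    (h1 : E 1 = 1) {m : ProWord Letter} (hm : m ≠ 1) :
    ∃ p : P, E p = m := by
  have hne : E.symm m ≠ 1 := fun h => hm (by rw [← E.apply_symm_apply m, h, h1])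
  obtain ⟨p, hp⟩ := WithOne.ne_one_iff_exists.1 hne
  exact ⟨p, by rw [hp, E.apply_symm_apply]⟩

/-! ### Transport to the free pro-`K` semigroup -/

section FreeSemigroup

variable {P : Type v} [Semigroup P] [TopologicalSpace P] {ι : Letter → P}
  {E : WithOne P ≃ₜ ProWord Letter}

theorem map_wordVal (h1 : E 1 = 1) (hmul : ∀ x y, E (x * y) = E x * E y)
    (hι : ∀ c, E (ι c) = ofList [c]) (l : List Letter) : E (wordVal ι l) = ofList l := by
  induction l with
  | nil => simpa using h1
  | cons c l ih => rw [wordVal_cons, hmul, hι, ih, ← ofList_cons]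

theorem isInfiniteWord_iff (h1 : E 1 = 1) (hmul : ∀ x y, E (x * y) = E x * E y)
    (hι : ∀ c, E (ι c) = ofList [c]) {s : ℕ → Letter} {p : P} :
    IsInfiniteWord ι s p ↔ E p = ofFun s := by
  have h : Tendsto (fun n => E (wordVal ι ((List.range n).map s))) atTop (𝓝 (ofFun s)) := by
    simp only [map_wordVal h1 hmul hι]
    exact tendsto_ofList_pre (ofFun s)
  rw [IsInfiniteWord, E.isInducing.tendsto_nhds_iff]
  exact ⟨fun h' => tendsto_nhds_unique h' h, fun h' => h' ▸ h⟩

/-- Powers of a letter are prefixes of the constant word, and `n! ≥ n` makes their lengths tend to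
infinity. -/
theorem isOmegaPower_iff (h1 : E 1 = 1) (hmul : ∀ x y, E (x * y) = E x * E y)
    (hι : ∀ c, E (ι c) = ofList [c]) {c : Letter} {p : P} :
    IsOmegaPower (ι c) p ↔ E p = ofFun fun _ => c := by
  have hpow (k : ℕ) : (ι c : WithOne P) ^ k = wordVal ι ((List.range k).map fun _ => c) := by
    simp [wordVal]
  have h : Tendsto (fun n => E ((ι c : WithOne P) ^ (n !))) atTop (𝓝 (ofFun fun _ => c)) := by
    simp only [hpow, map_wordVal h1 hmul hι]
    exact (tendsto_ofList_pre (ofFun fun _ => c)).comp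
      (tendsto_atTop_mono Nat.self_le_factorial tendsto_id)
  rw [IsOmegaPower, E.isInducing.tendsto_nhds_iff]
  exact ⟨fun h' => tendsto_nhds_unique h' h, fun h' => h' ▸ h⟩

theorem cantorPair_iff (h1 : E 1 = 1) (hmul : ∀ x y, E (x * y) = E x * E y)
    (hι : ∀ c, E (ι c) = ofList [c]) {p q : P} :
    CantorPair ι p q ↔ DyadicPair (E p) (E q) := by
  have key (w : List Letter) (c : Letter) (f : P) :
      E (wordVal ι w * ((ι c * f : P) : WithOne P)) = ofList w * (ofList [c] * E f) := by
    rw [hmul, map_wordVal h1 hmul hι, WithOne.coe_mul, hmul, hι]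
  simp only [CantorPair, DyadicPair, isOmegaPower_iff h1 hmul hι]
  constructor
  · rintro ⟨w, e, f, he, hf, hp, hq⟩
    exact ⟨w, by rw [hp, key, hf], by rw [hq, key, he]⟩
  · rintro ⟨w, hp, hq⟩
    obtain ⟨e, he⟩ := exists_coe_of_ne_one h1 (ofFun_ne_one fun _ => Letter.a)
    obtain ⟨f, hf⟩ := exists_coe_of_ne_one h1 (ofFun_ne_one fun _ => Letter.b)
    exact ⟨w, e, f, he, hf, E.injective (by rw [hp, key, hf]), E.injective (by rw [hq, key, he])⟩

/-- The closed congruence generated by `(a b^ω, b a^ω)` is the kernel of the Cantor function. -/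
theorem cantorCon_iff (h1 : E 1 = 1) (hmul : ∀ x y, E (x * y) = E x * E y)
    (hι : ∀ c, E (ι c) = ofList [c]) {p q : P} :
    cantorCon ι p q ↔ cantor (E p) = cantor (E q) := by
  -- The Cantor kernel is a closed congruence containing the generating pair, hence contains the
  -- least one.
  let R : Con P :=
    { r := fun p q => cantor (E p) = cantor (E q)
      iseqv := ⟨fun _ => rfl, Eq.symm, Eq.trans⟩
      mul' := fun h h' => by
        rw [WithOne.coe_mul, WithOne.coe_mul, hmul, hmul]
        exact cantor_mul_congr h h' }
  have hcoe : Continuous fun p : P => cantor (E p) :=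
    continuous_cantor.comp (E.continuous.comp continuous_coinduced_rng)
  constructor
  · have hle : cantorCon ι ≤ R := by
      refine sInf_le ⟨isClosed_eq (hcoe.comp continuous_fst) (hcoe.comp continuous_snd), ?_⟩
      rintro p q ⟨e, f, he, hf, rfl, rfl⟩
      refine DyadicPair.cantor_eq ((cantorPair_iff h1 hmul hι).1 ⟨[], e, f, he, hf, ?_, ?_⟩) <;>
        simp
    exact fun h => hle h
  -- Nontrivial pairs of the kernel are, up to symmetry, left translates of the generating pair, so
  -- any congruence containing the generator contains them.
  · have hle : R ≤ cantorCon ι := by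
      refine le_sInf ?_
      rintro c ⟨-, hc⟩
      have hpair {p q : P} (h : CantorPair ι p q) : c p q := by
        obtain ⟨w, e, f, he, hf, hp, hq⟩ := h
        have hgen := hc _ _ ⟨e, f, he, hf, rfl, rfl⟩
        revert hp hq
        induction wordVal ι w using WithOne.recOneCoe with
        | one =>
          rw [one_mul, one_mul, WithOne.coe_inj, WithOne.coe_inj]
          rintro rfl rfl
          exact hgen
        | coe u =>
          rw [← WithOne.coe_mul, ← WithOne.coe_mul, WithOne.coe_inj, WithOne.coe_inj]
          rintro rfl rfl
          exact c.mul (c.refl u) hgen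
      intro p q h
      rcases cantor_eq_iff.1 (show cantor (E p) = cantor (E q) from h) with h | h | h
      · rw [WithOne.coe_inj.1 (E.injective h)]
        exact c.refl q
      · exact hpair ((cantorPair_iff h1 hmul hι).2 h)
      · exact c.symm (hpair ((cantorPair_iff h1 hmul hι).2 h))
    exact fun h => hle h

end FreeSemigroup

/-! ### Transport to the free pro-`K^u` algebra -/

section FreeUnary

variable {F : Type u} [SMul Letter F] [TopologicalSpace F] (G : F ≃ₜ ProWord Letter)

/-- Continuous endomorphisms are right multiplications. -/
theorem map_eq_mul (hG : ∀ (c : Letter) y, G (c • y) = ofList [c] * G y) {x : F} (hx : G x = 1) (f : F →[Letter] F)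
    (hf : Continuous f) (y : F) : G (f y) = G y * G (f x) := by
  have hword (l : List Letter) (y : F) : G (wordAct l y) = ofList l * G y := by
    induction l with
    | nil => simp
    | cons c l ih => rw [wordAct_cons, hG, ih, ← mul_assoc, ← ofList_cons]
  -- Equivariance gives the equality on finite words, which are dense.
  have h : (fun m => G (f (G.symm m))) = fun m => m * G (f x) := by
    refine denseRange_ofList.equalizer (G.continuous.comp (hf.comp G.symm.continuous))
      (continuous_mul_const _) (funext fun l => ?_)
    have : G.symm (ofList l) = wordAct l x := by
      rw [G.symm_apply_eq, hword, hx, mul_one]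
    simp only [Function.comp, this, map_wordAct, hword]
  simpa using congrFun h (G y)

variable (hG : ∀ (c : Letter) y, G (c • y) = ofList [c] * G y)

/-- The kernel of the Cantor function on a unary algebra of words. -/
def kernelCon : SMulCon Letter F where
  r y z := cantor (G y) = cantor (G z)
  iseqv := ⟨fun _ => rfl, Eq.symm, Eq.trans⟩
  smul c _ _ h := by
    rw [hG, hG]
    exact cantor_mul_congr rfl h

/-- The Cantor function on the quotient by its kernel. -/
noncomputable def quotientCantor : (kernelCon G hG).Quotient → ℝ × ℝ :=
  Quotient.lift (fun y => cantor (G y)) fun _ _ h => h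

theorem isClosedCon_kernelCon : IsClosedCon (kernelCon G hG) :=
  isClosed_eq (continuous_cantor.comp (G.continuous.comp continuous_fst))
    (continuous_cantor.comp (G.continuous.comp continuous_snd))

/-- Endomorphisms are right multiplications, and the kernel is compatible with multiplication on the
right as well. -/
theorem isFullyInvariant_kernelCon {x : F} (hx : G x = 1) :
    IsFullyInvariant (kernelCon G hG) := by
  intro f hf y z h
  change cantor (G (f y)) = cantor (G (f z))
  rw [map_eq_mul G hG hx f hf y, map_eq_mul G hG hx f hf z]
  exact cantor_mul_congr h rfl

theorem isClosedEmbedding_quotientCantor : IsClosedEmbedding (quotientCantor G hG) := by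
  have : CompactSpace F := G.symm.compactSpace
  have : CompactSpace (kernelCon G hG).Quotient :=
    inferInstanceAs (CompactSpace (Quotient (kernelCon G hG).toSetoid))
  refine Continuous.isClosedEmbedding ?_ ?_
  · exact (continuous_cantor.comp G.continuous).quotient_lift _
  · rintro ⟨y⟩ ⟨z⟩ h
    exact Quotient.sound h

/-- The unit interval embeds in the quotient through binary expansions. -/
theorem exists_unitInterval_embedding :
    ∃ g : unitInterval → (kernelCon G hG).Quotient, IsClosedEmbedding g ∧
      ∀ t, quotientCantor G hG (g t) = ((t : ℝ), 0) := by
  have hex (t : unitInterval) : ∃ z, quotientCantor G hG z = ((t : ℝ), 0) := by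
    obtain ⟨x, -, hx⟩ := Real.ofDigits_SurjOn one_lt_two t.2
    let s : ℕ → Letter := fun n => if x n = 0 then Letter.a else Letter.b
    have hs : (fun n => (s n).digit) = x := by
      funext n
      by_cases h : x n = 0
      · simp [s, h, Letter.digit]
      · simp only [s, h, if_false, Letter.digit]
        omega
    refine ⟨Quotient.mk _ (G.symm (ofFun s)), ?_⟩
    change cantor (G (G.symm (ofFun s))) = _
    rw [G.apply_symm_apply, cantor, value_ofFun, gap_ofFun, hs, hx]
  choose g hg using hex
  have hκ := isClosedEmbedding_quotientCantor G hG
  -- Continuity of `g`, chosen pointwise, is inherited from the composite, as `quotientCantor` is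
  -- itself a closed embedding.
  have hcomp : IsClosedEmbedding (quotientCantor G hG ∘ g) := by
    rw [show quotientCantor G hG ∘ g = fun t : unitInterval => ((t : ℝ), (0 : ℝ)) from funext hg]
    refine Continuous.isClosedEmbedding (by fun_prop) fun s t h => ?_
    exact Subtype.ext (congrArg Prod.fst h)
  exact ⟨g, (hκ.of_comp_iff).1 hcomp, hg⟩

/-- A locally constant map is constant along the connected image of the interval, so the images of
its endpoints cannot be separated. -/
theorem not_isProfiniteCon_kernelCon : ¬ IsProfiniteCon (kernelCon G hG) := by
  intro h
  obtain ⟨g, hg, -⟩ := exists_unitInterval_embedding G hG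
  obtain ⟨T, _, -, f, hf, hne⟩ := h.separated (g 0) (g 1) fun h => zero_ne_one (hg.injective h)
  exact hne ((hf.comp_continuous hg.continuous).apply_eq_of_preconnectedSpace 0 1)

end FreeUnary

end ProWord

end ProUnary

theorem theorem5p10 :
    -- `K^u` is a pseudovariety of unary algebras with two operations `a`, `b`
    IsUnaryPseudovariety (unaryOf pseudoK Letter) ∧
    -- the free objects in play exist
    (∃ (P : Type) (_ : Semigroup P) (_ : TopologicalSpace P) (ι : Letter → P),
      IsFreeProSemigroup.{0, w} finiteSemigroups ι) ∧
    (∃ (P : Type) (_ : Semigroup P) (_ : TopologicalSpace P) (ι : Letter → P),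
      IsFreeProSemigroup.{0, w} pseudoK ι) ∧
    (∃ (F : Type) (_ : SMul Letter F) (_ : TopologicalSpace F) (x : F),
      IsFreeProUnary.{0, w} (unaryOf pseudoK Letter) x) ∧
    -- for the free pro-`K` semigroup `P` over `{a, b}` and the free pro-`K^u` algebra `F` over `x`
    ∀ (P : Type v) [Semigroup P] [TopologicalSpace P] (ι : Letter → P)
      (F : Type u) [SMul Letter F] [TopologicalSpace F] (x : F),
      IsFreeProSemigroup.{v, w} pseudoK ι →
      IsFreeProUnary.{u, w} (unaryOf pseudoK Letter) x →
      -- the congruence `θ` of the Cantor function on `P`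
      IsClosed {z : P × P | cantorCon ι z.1 z.2} ∧
      (∀ p q : P, cantorCon ι p q ↔ p = q ∨ CantorPair ι p q ∨ CantorPair ι q p) ∧
      -- the isomorphism `F ≅ P^I` of topological algebras
      ∃ Φ : F ≃ₜ WithOne P,
        Φ x = 1 ∧ (∀ (c : Letter) (y : F), Φ (c • y) = (ι c : WithOne P) * Φ y) ∧
        -- the congruence on `F` that corresponds to `θ` extended by the singleton class `{1}`
        ∃ r : SMulCon Letter F,
          (∀ y z : F, r.toSetoid y z ↔
            y = z ∨ ∃ p q : P, Φ y = p ∧ Φ z = q ∧ cantorCon ι p q) ∧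
          IsClosedCon r ∧ IsFullyInvariant r ∧ ¬ IsProfiniteCon r ∧
          -- the infinite words form a closed copy of `[0, 1]` in the quotient,
          -- through their binary expansions
          ∃ g : unitInterval → r.Quotient, IsClosedEmbedding g ∧
            ∀ s : ℕ → Letter, ∃ p : P, IsInfiniteWord ι s p ∧
              ∀ t : unitInterval, (t : ℝ) = Real.ofDigits (fun n => (s n).digit) →
                g t = Quotient.mk r.toSetoid (Φ.symm (p : WithOne P)) := by
  open ProWord in
  refine ⟨isUnaryPseudovariety_unaryOf_pseudoK Letter,
    exists_isFreeProSemigroup_finite Letter,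
    ⟨pos Letter, inferInstance, inferInstance, letter, isFreeProSemigroup_pos Letter⟩,
    ⟨ProWord Letter, inferInstance, inferInstance, 1, isFreeProUnary Letter⟩, ?_⟩
  intro P _ _ ι F _ _ x hP hF
  obtain ⟨E, h1, hmul, hι⟩ := exists_homeomorph_withOne hP
  obtain ⟨G, hGx, hG⟩ := exists_homeomorph_unary hF
  have hcoe : Continuous fun p : P => cantor (E p) :=
    continuous_cantor.comp (E.continuous.comp continuous_coinduced_rng)
  have hEΦ (y : F) : E (E.symm (G y)) = G y := E.apply_symm_apply _
  refine ⟨?_, fun p q => ?_, G.trans E.symm, ?_, fun c y => ?_, kernelCon G hG, fun y z => ?_,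
    isClosedCon_kernelCon G hG, isFullyInvariant_kernelCon G hG hGx,
    not_isProfiniteCon_kernelCon G hG, ?_⟩
  · simp only [cantorCon_iff h1 hmul hι]
    exact isClosed_eq (hcoe.comp continuous_fst) (hcoe.comp continuous_snd)
  · rw [cantorCon_iff h1 hmul hι, cantor_eq_iff, cantorPair_iff h1 hmul hι,
      cantorPair_iff h1 hmul hι, E.injective.eq_iff, WithOne.coe_inj]
  · change E.symm (G x) = 1
    rw [hGx, E.symm_apply_eq, h1]
  · change E.symm (G (c • y)) = ι c * E.symm (G y)
    rw [hG, E.symm_apply_eq, hmul, hι, hEΦ]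
  · change cantor (G y) = cantor (G z) ↔ y = z ∨ ∃ p q : P, E.symm (G y) = p ∧
      E.symm (G z) = q ∧ cantorCon ι p q
    simp only [cantorCon_iff h1 hmul hι, E.symm_apply_eq]
    constructor
    · intro h
      -- The empty word is alone in its class by `eq_ofList_of_cantor_eq`; all other words come from
      -- `P`.
      by_cases hy : G y = 1
      · rw [hy, ← ofList_nil] at h
        exact Or.inl (G.injective (hy.trans (by rw [eq_ofList_of_cantor_eq h.symm, ofList_nil])))
      by_cases hz : G z = 1
      · rw [hz, ← ofList_nil] at h
        exact absurd (by rw [eq_ofList_of_cantor_eq h, ofList_nil]) hy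
      obtain ⟨p, hp⟩ := exists_coe_of_ne_one h1 hy
      obtain ⟨q, hq⟩ := exists_coe_of_ne_one h1 hz
      exact Or.inr ⟨p, q, hp.symm, hq.symm, by rw [hp, hq, h]⟩
    · rintro (rfl | ⟨p, q, hp, hq, h⟩)
      · rfl
      · rw [hp, hq, h]
  · obtain ⟨g, hg, hgt⟩ := exists_unitInterval_embedding G hG
    refine ⟨g, hg, fun s => ?_⟩
    obtain ⟨p, hp⟩ := exists_coe_of_ne_one h1 (ofFun_ne_one s)
    refine ⟨p, (isInfiniteWord_iff h1 hmul hι).2 hp, fun t ht => ?_⟩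
    -- Classes are compared through their Cantor images: both have value `t` and gap zero.
    apply (isClosedEmbedding_quotientCantor G hG).injective
    rw [hgt]
    change _ = cantor (G (G.symm (E p)))
    rw [G.apply_symm_apply, hp, cantor, value_ofFun, gap_ofFun, ht]
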